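/- Let $d,m,n\in\mathbb N$, let $t_1,\dots,t_m\in[0,1)^d$ be pairwise different, $c\in(\mathbb C\setminus\{0\})^m$, $f(k)=\sum_{j=1}^m c_je^{-2\pi\iota\langle t_j,k\rangle}$ for $k\in\mathbb Z^d$, and $z_j=(e^{-2\pi\iota t_j(1)},\dots,e^{-2\pi\iota t_j(d)})$. Put $I_n=\{0,\dots,n\}^d$, $N=(n+1)^d$, $T=[f(k-h)]_{k,h\in I_n}$, $T_\ell=[f(k-h+e_\ell)]_{k,h\in I_n}$, and assume $\operatorname{rank}T=m$. Let $\sigma_1\ge\dots\ge\sigma_N$ be the singular values of $T$, $T=U\Sigma V^*$ a reduced SVD with $\Sigma=\operatorname{diag}(\sigma_1,\dots,\sigma_m)$, $S_\ell=U^*T_\ell V\Sigma^{-1}$, and $C_\mu=\sum_\ell\mu_\ell S_\ell$ for a fixed $\mu\in\mathbb C^d$ with $\|\mu\|_2=1$. Assume that the eigenvalues $\lambda_1,\dots,\lambda_m$ of $C_\mu$ are distinct, and let $W$ have as columns corresponding unit eigenvectors. Noisy data: for $\varepsilon\ge0$ let $|\tilde f(k)-f(k)|\le\varepsilon|f(k)|$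 for all $k$, and form $\tilde T,\tilde T_\ell$ from $\tilde f$ in the same way. Let $\tilde\sigma_1\ge\dots\ge\tilde\sigma_N$ be the singular values of $\tilde T$; let $\tilde U,\tilde V\in\mathbb C^{N\times m}$ hold the left and right singular vectors of an SVD of $\tilde T$ for $\tilde\sigma_1,\dots,\tilde\sigma_m$; put $\tilde\Sigma=\operatorname{diag}(\tilde\sigma_1,\dots,\tilde\sigma_m)$, $\tilde S_\ell=\tilde U^*\tilde T_\ell\tilde V\tilde\Sigma^{-1}$, $\tilde C_\mu=\sum_\ell\mu_\ell\tilde S_\ell$. Assume that the eigenvalues of $\tilde C_\mu$ are distinct, enumerate them as $\tilde\lambda_1,\dots,\tilde\lambda_m$ in any order, let $\tilde W$ have as columns corresponding unit eigenvectors, and let $\tilde z_j(\ell)=(\tilde W^{-1}\tilde S_\ell\tilde W)_{jj}$. Then there is a permutation $\tau$, depending only on the exact data and $W$, such that $W^{-1}S_\ell W=\operatorname{diag}(z_{\tau(1)}(\ell),\dots,z_{\tau(m)}(\ell))$ for all $\ell$; renumber the nodes and coefficients so that $\tau=\mathrm{id}$. Let $A=\big[\prod_\ell z_j(\ell)^{k(\ell)}\big]_{j\le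 m,\,k\in I_n}$, $\tilde A=\big[\prod_\ell\tilde z_j(\ell)^{k(\ell)}\big]_{j\le m,\,k\in I_n}$, let $\kappa_2$ be the ratio of the largest to the smallest singular value, and let $$\zeta=\max\Big\{\frac{\|\tilde A-A\|_F}{\|A\|_F},\ \frac{\varepsilon}{\sqrt m}\Big\},$$ the least number with $\|\tilde A-A\|_F\le\zeta\|A\|_F$ and $\varepsilon\le\sqrt m\,\zeta$. The following hold. (1) If $\kappa_2(A)\sqrt m\,\zeta<1$, then every minimizer $\tilde c$ of $\|\tilde A^Tx-(\tilde f(k))_{k\in I_n}\|_2$ satisfies $$\frac{\|\tilde c-c\|_2}{\|c\|_2}\le\frac{2\kappa_2(A)\sqrt m\,\zeta}{1-\kappa_2(A)\sqrt m\,\zeta}.$$ (2) Let $m\ge2$, and let $$\gamma=\min_{j\ne i}|\lambda_j-\tilde\lambda_i|,\qquad \delta_{\min}=\min_{i\le m}\min\Big\{\min_{j\le N,\,j\ne i}|\sigma_i-\tilde\sigma_j|,\ \sigma_i\Big\},\qquad Q=\frac{d^{3/2}m^{3/2}nN^{1/2}\,\|T\|_F\,\max_\ell\|T_\ell\|_F\,\kappa_2(W)}{\gamma\,\delta_{\min}\,\tilde\sigma_m\,\sigma_{\min}(W)}.$$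 There are an absolute constant $C$ and constants $K,\varepsilon_0>0$ that depend only on the exact data ($d,m,n,t,c,\mu,U,V,W$), such that, whenever $0\le\varepsilon\le\varepsilon_0$, $\gamma>0$ and $\delta_{\min}>0$, $$\zeta\le C\,Q\,\varepsilon+K\varepsilon^2,$$ and, if moreover $\kappa_2(A)\sqrt m\,\zeta<1$, $$\frac{2\kappa_2(A)\sqrt m\,\zeta}{1-\kappa_2(A)\sqrt m\,\zeta}\le C\,\sqrt m\,\kappa_2(A)\,Q\,\varepsilon+K\varepsilon^2 .$$ So the forward error in the coefficients is, to first order, proportional to $\varepsilon$. -/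

import Mathlib

open scoped Matrix Matrix.Norms.Frobenius

noncomputable section

namespace Prony

/-- The index set `I_n = {0, …, n}^d`. -/
abbrev Grid (d n : ℕ) : Type := Fin d → Fin (n + 1)

/-- The exponential sum `f(k) = ∑ⱼ cⱼ exp(-2πi ⟨tⱼ, k⟩)`. -/
def expSum {d m : ℕ} (t : Fin m → Fin d → ℝ) (c : Fin m → ℂ) (k : Fin d → ℤ) : ℂ :=
  ∑ j, c j * Complex.exp (-2 * Real.pi * Complex.I * ∑ l, (t j l : ℂ) * (k l : ℂ))

/-- The nodes `zⱼ = exp(-2πi tⱼ)`, componentwise. -/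
def nodes {d m : ℕ} (t : Fin m → Fin d → ℝ) (j : Fin m) (l : Fin d) : ℂ :=
  Complex.exp (-2 * Real.pi * Complex.I * (t j l : ℂ))

/-- `T = [g(k - h)]`, indexed by `k, h ∈ I_n`. -/
def sampleMatrix {d : ℕ} (n : ℕ) (g : (Fin d → ℤ) → ℂ) : Matrix (Grid d n) (Grid d n) ℂ :=
  Matrix.of fun k h => g fun i => ((k i : ℕ) : ℤ) - ((h i : ℕ) : ℤ)

/-- `T_l = [g(k - h + e_l)]`, indexed by `k, h ∈ I_n`. -/
def shiftedMatrix {d : ℕ} (n : ℕ) (g : (Fin d → ℤ) → ℂ) (l : Fin d) :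
    Matrix (Grid d n) (Grid d n) ℂ :=
  Matrix.of fun k h => g ((fun i => ((k i : ℕ) : ℤ) - ((h i : ℕ) : ℤ)) + Pi.single l 1)

/-- The vector `[g(k)]`, indexed by `k ∈ I_n`. -/
def sampleVector {d : ℕ} (n : ℕ) (g : (Fin d → ℤ) → ℂ) : Grid d n → ℂ :=
  fun k => g fun i => ((k i : ℕ) : ℤ)

/-- The matrix `A = [zⱼ^k]`, where `zⱼ^k = ∏_l zⱼ(l)^{k(l)}`, of a family of nodes. -/
def nodeMatrix {d m : ℕ} (n : ℕ) (z : Fin m → Fin d → ℂ) : Matrix (Fin m) (Grid d n) ℂ :=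
  Matrix.of fun j k => ∏ l, z j l ^ (k l : ℕ)

/-- The Euclidean norm of a complex vector. -/
def norm2 {ι : Type*} [Fintype ι] (v : ι → ℂ) : ℝ := ‖WithLp.toLp 2 v‖

section SingularValues

variable {ι κ : Type*} [Fintype ι] [Fintype κ] [DecidableEq ι] [DecidableEq κ]

/-- Singular values in nonincreasing order, numbered from `0`. -/
def sv (M : Matrix ι κ ℂ) (i : ℕ) : ℝ := (Matrix.toEuclideanLin M).singularValues i

/-- The smallest singular value. -/
def svMin (M : Matrix ι κ ℂ) : ℝ := sv M (min (Fintype.card ι) (Fintype.card κ) - 1)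

/-- The spectral condition number `κ₂`. -/
def cond2 (M : Matrix ι κ ℂ) : ℝ := sv M 0 / svMin M

/-- The diagonal matrix of the `m` largest singular values. -/
def svDiag (m : ℕ) (M : Matrix ι κ ℂ) : Matrix (Fin m) (Fin m) ℂ :=
  Matrix.diagonal fun i => (sv M i : ℂ)

/-- The columns of `U` and `V` are left and right singular vectors for the `m` largest singular
values in a singular value decomposition
`M = [U U'] diag(Σ, Σ') [V V']ᴴ = U Σ Vᴴ + U' Σ' V'ᴴ` of the square matrix `M`.
If `M` has rank `m`, then `Σ' = 0` and `M = U Σ Vᴴ` is the reduced decomposition. -/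
def IsDominantSVD {m : ℕ} (M : Matrix ι ι ℂ) (U V : Matrix ι (Fin m) ℂ) : Prop :=
  ∃ U' V' : Matrix ι (Fin (Fintype.card ι - m)) ℂ,
    (Matrix.fromCols U U')ᴴ * Matrix.fromCols U U' = 1 ∧
    (Matrix.fromCols V V')ᴴ * Matrix.fromCols V V' = 1 ∧
    M = U * svDiag m M * Vᴴ +
      U' * Matrix.diagonal (fun j : Fin (Fintype.card ι - m) => (sv M (m + j) : ℂ)) * V'ᴴ

end SingularValues

/-- `S_l = Uᴴ T_l V Σ⁻¹`. -/
def pencilMatrix {d m : ℕ} (n : ℕ) (g : (Fin d → ℤ) → ℂ) (U V : Matrix (Grid d n) (Fin m) ℂ)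
    (l : Fin d) : Matrix (Fin m) (Fin m) ℂ :=
  Uᴴ * shiftedMatrix n g l * V * (svDiag m (sampleMatrix n g))⁻¹

/-- The computation of the pencil method on the samples `g`: `U`, `V` are dominant singular vectors
of `T`, the columns of `W` are unit eigenvectors of `C_μ = ∑_l μ_l S_l`, and the eigenvalues `lam`
are pairwise different. -/
structure IsPencilRun {d m : ℕ} (n : ℕ) (g : (Fin d → ℤ) → ℂ) (μ : Fin d → ℂ)
    (U V : Matrix (Grid d n) (Fin m) ℂ) (W : Matrix (Fin m) (Fin m) ℂ) (lam : Fin m → ℂ) :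
    Prop where
  svd : IsDominantSVD (sampleMatrix n g) U V
  unit_col : ∀ j, norm2 (W.col j) = 1
  eigen : (∑ l, μ l • pencilMatrix n g U V l) * W = W * Matrix.diagonal lam
  distinct : Function.Injective lam

/-- The nodes read off the diagonals: `zⱼ(l) = (W⁻¹ S_l W)(j, j)`. -/
def extractedNodes {d m : ℕ} (n : ℕ) (g : (Fin d → ℤ) → ℂ)
    (U V : Matrix (Grid d n) (Fin m) ℂ) (W : Matrix (Fin m) (Fin m) ℂ)
    (j : Fin m) (l : Fin d) : ℂ :=
  (W⁻¹ * pencilMatrix n g U V l * W) j j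

/-- `x` minimizes `‖B x - b‖₂`. -/
def IsLeastSquares {ι κ : Type*} [Fintype ι] [Fintype κ]
    (B : Matrix ι κ ℂ) (b : ι → ℂ) (x : κ → ℂ) : Prop :=
  ∀ y : κ → ℂ, norm2 (B *ᵥ x - b) ≤ norm2 (B *ᵥ y - b)

/-- `ζ`, the relative level of the perturbations in the least squares problem: the least number
with `‖A' - A‖_F ≤ ζ ‖A‖_F` and `ε ≤ √m ζ`. -/
def lsqLevel {d m n : ℕ} (A A' : Matrix (Fin m) (Grid d n) ℂ) (ε : ℝ) : ℝ :=
  max (‖A' - A‖ / ‖A‖) (ε / √(m : ℝ))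

/-- `γ = min_{j ≠ i} |lam_j - lam'_i|`. -/
def eigGap {m : ℕ} (lam lam' : Fin m → ℂ) : ℝ :=
  ⨅ p : {p : Fin m × Fin m // p.2 ≠ p.1}, ‖lam p.1.2 - lam' p.1.1‖

/-- `δ_min = min_{i ≤ m} δ_i` with `δ_i = min {min_{j ≤ N, j ≠ i} |σ_i - σ'_j|, σ_i}`, for the
singular values `σ` of `T` and `σ'` of `T'`. -/
def svGap {ι : Type*} [Fintype ι] [DecidableEq ι] (m : ℕ) (T T' : Matrix ι ι ℂ) : ℝ :=
  ⨅ i : Fin m,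
    min (⨅ j : {j : Fin (Fintype.card ι) // (j : ℕ) ≠ (i : ℕ)}, |sv T i - sv T' j.1|) (sv T i)

/-- The factor
`d^{3/2} m^{3/2} n N^{1/2} ‖T‖_F max_l ‖T_l‖_F κ₂(W) / (γ δ_min σ'_m σ_min(W))`,
where `N = (n+1)^d`, for exact samples `f` and noisy samples `f'`. -/
def amplification {d m : ℕ} (n : ℕ) (f f' : (Fin d → ℤ) → ℂ) (W : Matrix (Fin m) (Fin m) ℂ)
    (lam lam' : Fin m → ℂ) : ℝ :=
  (d : ℝ) ^ (3 / 2 : ℝ) * (m : ℝ) ^ (3 / 2 : ℝ) * n * √(((n : ℝ) + 1) ^ d) *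
      ‖sampleMatrix n f‖ * (⨆ l : Fin d, ‖shiftedMatrix n f l‖) * cond2 W /
    (eigGap lam lam' * svGap m (sampleMatrix n f) (sampleMatrix n f') *
      sv (sampleMatrix n f') (m - 1) * svMin W)

end Prony

end

/-!
# Forward errors in a multivariate matrix pencil method

Write `B = Aᵀ` for the transposed node matrix, `D = diag c` and `Z_l` for the diagonal matrix of the
`l`-th node coordinates. The exact matrices factor as `T = B D Bᴴ` and `T_l = B D Z_l Bᴴ`, so
`S_l = X Z_l X⁻¹` with `X = Uᴴ B D`. As the eigenvalues of `C_μ` are distinct, `W` is `X` up to a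
permutation and a scaling of its columns, which yields `τ` (`IsPencilRun.exists_perm`). The nodes
are renumbered so that `τ = 1`.

*Coefficients.* The error of a least squares solution in the range is an orthogonal projection of
the residual of the exact coefficients (`IsLeastSquares.norm2_mulVec_sub_le`). That residual is
bounded by the perturbations of `A` and of the samples, and `σ_min(A)` minus the perturbation of `A`
bounds the perturbed matrix from below (`IsLeastSquares.forward_error`).

*Nodes.* No perturbation theory for singular vectors is needed beyond the fact that `Ũᴴ U` is
well-conditioned (`IsDominantSVD.half_norm2_le`). Put `Y = Ũᴴ U W`. The factored form of the exact
data gives the identity `Y⁻¹ S̃_l Y = Z_l + H_l`, where `T̃ - T` or `T̃_l - T_l` is a factor of each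
term of `H_l` (`pencil_similar`), and the Frobenius norm of `H_l` is at most `h₀ = 2 ε m (max ‖T_l‖
+ ‖T‖) / (σ_min(W) σ̃_m)` (`IsPencilRun.exists_similar`). A left and a right eigenvector of `diag
lam + ∑ l, μ l • H_l` for the same eigenvalue are both concentrated in one entry `p`, so the
extracted node equals the `p`-th exact node up to `2 h₀ + O(h₀²)` (`exists_eigenpair_near`).

*The two numberings.* The index `p` depends on the index `i` of the noisy eigenvalue. If `p = i` for
all `i`, then `‖Ã - A‖_F ≤ (4 n d h₀ + O(ε²)) ‖A‖_F`, and `Q` dominates the coefficient of `ε`,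
because `δ_min ≤ σ_m ≤ min {‖T‖, ‖T_l‖}` and `γ ≤ 3 √d`; since `σ̃_m ≤ 2 σ_m`, also `6 Q ≥ 1`, which
takes care of the term `ε / √m` of `ζ`. If `p ≠ i` for some `i`, then `γ ≤ |lam p - lam' i| ≤ √d
h₀`. In that case `Q ε ≥ 1 / 4`, whereas `ζ` is at most an absolute constant. Moreover the `i`-th
row of `Ã` is near another row of `A`, so `‖Ã - A‖_F ≥ σ_min(A)` and `κ₂(A) √m ζ ≥ 1`, and the last
estimate has nothing to show (`svMin_le_norm_nodeMatrix_sub`).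
-/

namespace Prony

/-! ### Euclidean and Frobenius norms -/

section Norms

variable {ι κ ν : Type*} [Fintype ι] [Fintype κ] [Fintype ν]

lemma norm2_nonneg (v : ι → ℂ) : 0 ≤ norm2 v := norm_nonneg _

lemma norm2_sq (v : ι → ℂ) : norm2 v ^ 2 = ∑ i, ‖v i‖ ^ 2 := by
  rw [norm2, EuclideanSpace.norm_sq_eq]

lemma norm2_add_le (v w : ι → ℂ) : norm2 (v + w) ≤ norm2 v + norm2 w := by
  rw [norm2, WithLp.toLp_add]; exact norm_add_le _ _

lemma norm2_sub_le (v w : ι → ℂ) : norm2 (v - w) ≤ norm2 v + norm2 w := by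
  rw [norm2, WithLp.toLp_sub]; exact norm_sub_le _ _

lemma norm2_eq_zero {v : ι → ℂ} : norm2 v = 0 ↔ v = 0 := by
  rw [norm2, norm_eq_zero, WithLp.toLp_eq_zero]

lemma norm2_star (v : ι → ℂ) : norm2 (star v) = norm2 v := by
  rw [← sq_eq_sq₀ (norm2_nonneg _) (norm2_nonneg _), norm2_sq, norm2_sq]
  simp

lemma norm_apply_le_norm2 (v : ι → ℂ) (i : ι) : ‖v i‖ ≤ norm2 v :=
  PiLp.norm_apply_le (WithLp.toLp 2 v) i

lemma norm2_le_of_sq_le {v : ι → ℂ} {a : ℝ} (ha : 0 ≤ a) (h : ∑ i, ‖v i‖ ^ 2 ≤ a ^ 2) :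
    norm2 v ≤ a :=
  le_of_sq_le_sq (by rwa [norm2_sq]) ha

lemma norm2_single [DecidableEq ι] (i : ι) (a : ℂ) : norm2 (Pi.single i a) = ‖a‖ := by
  rw [norm2]; exact PiLp.norm_single 2 (fun _ => ℂ) i a

lemma norm_dotProduct_le (v w : ι → ℂ) : ‖v ⬝ᵥ w‖ ≤ norm2 v * norm2 w := by
  have h := norm_inner_le_norm (𝕜 := ℂ) (WithLp.toLp 2 (star v)) (WithLp.toLp 2 w)
  rw [EuclideanSpace.inner_toLp_toLp, star_star, dotProduct_comm] at h
  exact h.trans (by rw [← norm2, ← norm2, norm2_star])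

lemma sum_norm_le_sqrt_card_mul (v : ι → ℂ) : ∑ i, ‖v i‖ ≤ √(Fintype.card ι) * norm2 v := by
  refine le_of_sq_le_sq ?_ (mul_nonneg (Real.sqrt_nonneg _) (norm2_nonneg v))
  have h := sq_sum_le_card_mul_sum_sq (s := Finset.univ) (f := fun i => ‖v i‖)
  rwa [← norm2_sq, Finset.card_univ, ← Real.sq_sqrt (Nat.cast_nonneg (Fintype.card ι)),
    ← mul_pow] at h

lemma frobenius_sq (M : Matrix ι κ ℂ) : ‖M‖ ^ 2 = ∑ i, ∑ j, ‖M i j‖ ^ 2 := by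
  have h0 : (0 : ℝ) ≤ ∑ i, ∑ j, ‖M i j‖ ^ 2 := by positivity
  rw [Matrix.frobenius_norm_def]
  simp only [Real.rpow_ofNat]
  rw [← Real.sqrt_eq_rpow, Real.sq_sqrt h0]

lemma frobenius_sq_cols (M : Matrix ι κ ℂ) : ‖M‖ ^ 2 = ∑ j, norm2 (M.col j) ^ 2 := by
  rw [frobenius_sq, Finset.sum_comm]
  simp only [norm2_sq, Matrix.col_apply]

lemma frobenius_sq_rows (M : Matrix ι κ ℂ) : ‖M‖ ^ 2 = ∑ i, norm2 (M i) ^ 2 := by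
  rw [frobenius_sq]
  simp only [norm2_sq]

lemma norm2_row_le (M : Matrix ι κ ℂ) (i : ι) : norm2 (M i) ≤ ‖M‖ := by
  refine le_of_sq_le_sq ?_ (norm_nonneg _)
  rw [frobenius_sq_rows]
  exact Finset.single_le_sum (f := fun i => norm2 (M i) ^ 2) (fun _ _ => sq_nonneg _)
    (Finset.mem_univ i)

lemma norm_entry_le (M : Matrix ι κ ℂ) (i : ι) (j : κ) : ‖M i j‖ ≤ ‖M‖ :=
  (norm_apply_le_norm2 (M i) j).trans (norm2_row_le M i)

lemma frobenius_le_of_entry_le {M P : Matrix ι κ ℂ} {a : ℝ} (ha : 0 ≤ a)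
    (h : ∀ i j, ‖M i j‖ ≤ a * ‖P i j‖) : ‖M‖ ≤ a * ‖P‖ := by
  refine le_of_sq_le_sq ?_ (by positivity)
  rw [mul_pow, frobenius_sq, frobenius_sq, Finset.mul_sum]
  refine Finset.sum_le_sum fun i _ => ?_
  rw [Finset.mul_sum]
  refine Finset.sum_le_sum fun j _ => ?_
  rw [← mul_pow]
  exact pow_le_pow_left₀ (norm_nonneg _) (h i j) 2

lemma frobenius_le_of_cols_le {M : Matrix ι κ ℂ} {P : Matrix ν κ ℂ} {a : ℝ} (ha : 0 ≤ a)
    (h : ∀ j, norm2 (M.col j) ≤ a * norm2 (P.col j)) : ‖M‖ ≤ a * ‖P‖ := by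
  refine le_of_sq_le_sq ?_ (by positivity)
  rw [mul_pow, frobenius_sq_cols, frobenius_sq_cols, Finset.mul_sum]
  refine Finset.sum_le_sum fun j _ => ?_
  rw [← mul_pow]
  exact pow_le_pow_left₀ (norm2_nonneg _) (h j) 2

omit [Fintype ι] [Fintype ν] in
lemma col_mul (P : Matrix ι κ ℂ) (M : Matrix κ ν ℂ) (j : ν) : (P * M).col j = P *ᵥ M.col j := rfl

lemma frobenius_mul_le_of_mulVec_le {P : Matrix ι κ ℂ} {a : ℝ} (ha : 0 ≤ a)
    (h : ∀ x, norm2 (P *ᵥ x) ≤ a * norm2 x) (M : Matrix κ ν ℂ) : ‖P * M‖ ≤ a * ‖M‖ :=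
  frobenius_le_of_cols_le ha fun j => by rw [col_mul]; exact h _

lemma norm2_mulVec_le (M : Matrix ι κ ℂ) (v : κ → ℂ) : norm2 (M *ᵥ v) ≤ ‖M‖ * norm2 v := by
  have h := Matrix.frobenius_norm_mul M (Matrix.replicateCol Unit v)
  rwa [← Matrix.replicateCol_mulVec, Matrix.frobenius_norm_replicateCol,
    Matrix.frobenius_norm_replicateCol] at h

lemma ofReal_norm2_sq (v : ι → ℂ) : ((norm2 v ^ 2 : ℝ) : ℂ) = star v ⬝ᵥ v := by
  rw [norm2_sq, dotProduct]
  push_cast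
  refine Finset.sum_congr rfl fun i _ => ?_
  rw [Pi.star_apply, ← Complex.conj_mul']
  rfl

lemma norm2_mulVec_of_isometry [DecidableEq κ] {U : Matrix ι κ ℂ} (hU : Uᴴ * U = 1) (x : κ → ℂ) :
    norm2 (U *ᵥ x) = norm2 x := by
  rw [← sq_eq_sq₀ (norm2_nonneg _) (norm2_nonneg _), ← Complex.ofReal_inj, ofReal_norm2_sq,
    ofReal_norm2_sq, Matrix.star_mulVec, ← Matrix.dotProduct_mulVec, Matrix.mulVec_mulVec, hU,
    Matrix.one_mulVec]

lemma norm2_conjTranspose_mulVec_le [DecidableEq κ] {U : Matrix ι κ ℂ} (hU : Uᴴ * U = 1)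
    (y : ι → ℂ) : norm2 (Uᴴ *ᵥ y) ≤ norm2 y := by
  have h : norm2 (Uᴴ *ᵥ y) ^ 2 ≤ norm2 y * norm2 (Uᴴ *ᵥ y) := by
    have e : ((norm2 (Uᴴ *ᵥ y) ^ 2 : ℝ) : ℂ) = star y ⬝ᵥ (U *ᵥ (Uᴴ *ᵥ y)) := by
      rw [ofReal_norm2_sq, Matrix.star_mulVec, Matrix.conjTranspose_conjTranspose,
        ← Matrix.dotProduct_mulVec]
    have h2 := norm_dotProduct_le (star y) (U *ᵥ (Uᴴ *ᵥ y))
    rw [← e, norm2_star, norm2_mulVec_of_isometry hU, Complex.norm_real, Real.norm_eq_abs] at h2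
    exact (le_abs_self _).trans h2
  rcases (norm2_nonneg (Uᴴ *ᵥ y)).eq_or_lt with h0 | h0
  · rw [← h0]; exact norm2_nonneg y
  · rw [sq] at h; exact le_of_mul_le_mul_right h h0

lemma frobenius_conjTranspose_mul_le [DecidableEq κ] {U : Matrix ι κ ℂ} (hU : Uᴴ * U = 1)
    (M : Matrix ι ν ℂ) : ‖Uᴴ * M‖ ≤ ‖M‖ := by
  simpa using frobenius_mul_le_of_mulVec_le zero_le_one
    (fun y => by simpa using norm2_conjTranspose_mulVec_le hU y) M

lemma frobenius_isometry_mul [DecidableEq κ] {U : Matrix ι κ ℂ} (hU : Uᴴ * U = 1)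
    (M : Matrix κ ν ℂ) : ‖U * M‖ = ‖M‖ := by
  rw [← sq_eq_sq₀ (norm_nonneg _) (norm_nonneg _), frobenius_sq_cols, frobenius_sq_cols]
  simp only [col_mul, norm2_mulVec_of_isometry hU]

lemma frobenius_mul_isometry_le [DecidableEq κ] {V : Matrix ι κ ℂ} (hV : Vᴴ * V = 1)
    (M : Matrix ν ι ℂ) : ‖M * V‖ ≤ ‖M‖ := by
  rw [← Matrix.frobenius_norm_conjTranspose, Matrix.conjTranspose_mul,
    ← Matrix.frobenius_norm_conjTranspose M]
  exact frobenius_conjTranspose_mul_le hV _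

lemma frobenius_diagonal_mul_le [DecidableEq ι] {a : ι → ℂ} {r : ℝ} (hr : 0 ≤ r)
    (ha : ∀ i, ‖a i‖ ≤ r) (M : Matrix ι κ ℂ) : ‖Matrix.diagonal a * M‖ ≤ r * ‖M‖ :=
  frobenius_le_of_entry_le hr fun i j => by
    rw [Matrix.diagonal_mul, norm_mul]
    exact mul_le_mul_of_nonneg_right (ha i) (norm_nonneg _)

lemma norm2_diagonal_mulVec_le [DecidableEq ι] {a : ι → ℂ} {r : ℝ} (hr : 0 ≤ r)
    (ha : ∀ i, ‖a i‖ ≤ r) (x : ι → ℂ) : norm2 (Matrix.diagonal a *ᵥ x) ≤ r * norm2 x := by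
  refine norm2_le_of_sq_le (mul_nonneg hr (norm2_nonneg x)) ?_
  rw [mul_pow, norm2_sq, Finset.mul_sum]
  refine Finset.sum_le_sum fun i _ => ?_
  rw [Matrix.mulVec_diagonal, norm_mul, mul_pow]
  gcongr
  exact ha i

lemma norm2_transpose_mulVec (M : Matrix ι κ ℂ) (y : ι → ℂ) :
    norm2 (Mᵀ *ᵥ y) = norm2 (Mᴴ *ᵥ star y) := by
  rw [← norm2_star, Matrix.star_mulVec]
  congr 1
  rw [← Matrix.mulVec_transpose]
  rfl

lemma frobenius_one [DecidableEq ι] : ‖(1 : Matrix ι ι ℂ)‖ = √(Fintype.card ι) := by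
  rw [← Real.sqrt_sq (norm_nonneg (1 : Matrix ι ι ℂ)), frobenius_sq_cols]
  congr 1
  have : ∀ j : ι, (1 : Matrix ι ι ℂ).col j = Pi.single j 1 := fun j => by
    ext i; simp [Matrix.one_apply, Pi.single_apply]
  simp [this, norm2_single]

lemma isUnit_of_norm2_lower_bound [DecidableEq ι] {M : Matrix ι ι ℂ} {s : ℝ} (hs : 0 < s)
    (h : ∀ x, s * norm2 x ≤ norm2 (M *ᵥ x)) : IsUnit M := by
  rw [← Matrix.mulVec_injective_iff_isUnit]
  intro x y hxy
  have h1 := h (x - y)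
  replace hxy : M *ᵥ x = M *ᵥ y := hxy
  rw [Matrix.mulVec_sub, hxy, sub_self, norm2_eq_zero.mpr rfl] at h1
  have h2 : norm2 (x - y) = 0 := le_antisymm (by nlinarith) (norm2_nonneg _)
  exact sub_eq_zero.mp (norm2_eq_zero.mp h2)

lemma frobenius_inv_le [DecidableEq ι] {M : Matrix ι ι ℂ} {s : ℝ} (hs : 0 < s)
    (h : ∀ x, s * norm2 x ≤ norm2 (M *ᵥ x)) : ‖M⁻¹‖ ≤ √(Fintype.card ι) / s := by
  have hM : IsUnit M.det := (Matrix.isUnit_iff_isUnit_det M).mp (isUnit_of_norm2_lower_bound hs h)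
  have h1 : ‖M⁻¹ * (1 : Matrix ι ι ℂ)‖ ≤ s⁻¹ * ‖(1 : Matrix ι ι ℂ)‖ :=
    frobenius_mul_le_of_mulVec_le (by positivity) (fun x => by
      have h2 := h (M⁻¹ *ᵥ x)
      rw [Matrix.mulVec_mulVec, Matrix.mul_nonsing_inv _ hM, Matrix.one_mulVec] at h2
      rwa [inv_mul_eq_div, le_div_iff₀' hs]) _
  rw [mul_one, frobenius_one, inv_mul_eq_div] at h1
  exact h1

end Norms

end Prony

/-! ### Singular values -/

namespace LinearMap

open Module

variable {𝕜 E F : Type*} [RCLike 𝕜]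
  [NormedAddCommGroup E] [InnerProductSpace 𝕜 E] [FiniteDimensional 𝕜 E]
  [NormedAddCommGroup F] [InnerProductSpace 𝕜 F] [FiniteDimensional 𝕜 F]

/-- An orthonormal basis of right singular vectors, in the order of the singular values,
diagonalizes the quadratic form `x ↦ ‖T x‖²`. -/
lemma exists_orthonormalBasis_norm_sq (T : E →ₗ[𝕜] F) {N : ℕ} (hN : finrank 𝕜 E = N) :
    ∃ v : OrthonormalBasis (Fin N) 𝕜 E, ∀ x,
      ‖T x‖ ^ 2 = ∑ i : Fin N, T.singularValues i ^ 2 * ‖inner 𝕜 (v i) x‖ ^ 2 := by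
  have hT := T.isSymmetric_adjoint_comp_self
  refine ⟨hT.eigenvectorBasis hN, fun x => ?_⟩
  set v := hT.eigenvectorBasis hN
  have h1 : inner 𝕜 (v.repr x) (v.repr ((adjoint T ∘ₗ T) x)) = ((‖T x‖ ^ 2 : ℝ) : 𝕜) := by
    rw [LinearIsometryEquiv.inner_map_map, comp_apply, adjoint_inner_right,
      inner_self_eq_norm_sq_to_K]
    push_cast; rfl
  have h2 : inner 𝕜 (v.repr x) (v.repr ((adjoint T ∘ₗ T) x)) =
      ((∑ i : Fin N, T.singularValues i ^ 2 * ‖inner 𝕜 (v i) x‖ ^ 2 : ℝ) : 𝕜) := by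
    rw [PiLp.inner_apply, RCLike.ofReal_sum]
    refine Finset.sum_congr rfl fun i _ => ?_
    rw [hT.eigenvectorBasis_apply_self_apply, ← T.sq_singularValues_fin hN, RCLike.inner_apply,
      OrthonormalBasis.repr_apply_apply, mul_assoc, RCLike.mul_conj]
    push_cast; rfl
  exact_mod_cast h1.symm.trans h2

/-- Weyl's inequality. -/
lemma singularValues_le_add (S T : E →ₗ[𝕜] F) {δ : ℝ} (hδ : 0 ≤ δ)
    (h : ∀ x, ‖S x - T x‖ ≤ δ * ‖x‖) (i : ℕ) : S.singularValues i ≤ T.singularValues i + δ := by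
  by_cases hi : finrank 𝕜 E ≤ i
  · rw [S.singularValues_of_finrank_le hi, T.singularValues_of_finrank_le hi]; simpa
  push Not at hi
  obtain ⟨N, hN⟩ : ∃ N, finrank 𝕜 E = N := ⟨_, rfl⟩
  rw [hN] at hi
  obtain ⟨v, hv⟩ := S.exists_orthonormalBasis_norm_sq hN
  obtain ⟨w, hw⟩ := T.exists_orthonormalBasis_norm_sq hN
  -- a vector that is orthogonal to `v j` for `j > i` and to `w j` for `j < i`: these are
  -- `N - 1` linear conditions
  let φ : E →ₗ[𝕜] ({j : Fin N // (j : ℕ) ≠ i} → 𝕜) := LinearMap.pi fun j =>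
    if (j : ℕ) < i then innerₛₗ 𝕜 (w j) else innerₛₗ 𝕜 (v j)
  have hker : ker φ ≠ ⊥ := by
    apply LinearMap.ker_ne_bot_of_finrank_lt
    rw [finrank_fintype_fun_eq_card, hN]
    conv_rhs => rw [← Fintype.card_fin N]
    exact Fintype.card_subtype_lt (x := ⟨i, hi⟩) (by simp)
  obtain ⟨x, hx, hx0⟩ := Submodule.exists_mem_ne_zero_of_ne_bot hker
  have hx' : ∀ j : Fin N, (hj : (j : ℕ) ≠ i) → φ x ⟨j, hj⟩ = 0 := fun j hj => by
    rw [mem_ker.mp hx]; rfl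
  have hvx : ∀ j : Fin N, i < j → inner 𝕜 (v j) x = 0 := fun j hj => by
    have := hx' j hj.ne'
    simpa [φ, hj.not_gt] using this
  have hwx : ∀ j : Fin N, (j : ℕ) < i → inner 𝕜 (w j) x = 0 := fun j hj => by
    have := hx' j hj.ne
    simpa [φ, hj] using this
  have hS : S.singularValues i * ‖x‖ ≤ ‖S x‖ := by
    refine le_of_sq_le_sq ?_ (norm_nonneg _)
    rw [hv, mul_pow, ← v.sum_sq_norm_inner_right x, Finset.mul_sum]
    refine Finset.sum_le_sum fun j _ => ?_
    rcases le_or_gt (j : ℕ) i with hj | hj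
    · gcongr
      · exact S.singularValues_nonneg i
      · exact S.singularValues_antitone hj
    · simp [hvx j hj]
  have hT : ‖T x‖ ≤ T.singularValues i * ‖x‖ := by
    refine le_of_sq_le_sq ?_ (mul_nonneg (T.singularValues_nonneg i) (norm_nonneg _))
    rw [hw, mul_pow, ← w.sum_sq_norm_inner_right x, Finset.mul_sum]
    refine Finset.sum_le_sum fun j _ => ?_
    rcases lt_or_ge (j : ℕ) i with hj | hj
    · simp [hwx j hj]
    · gcongr
      · exact T.singularValues_nonneg j
      · exact T.singularValues_antitone hj
  have hx1 : 0 < ‖x‖ := norm_pos_iff.mpr hx0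
  refine le_of_mul_le_mul_right ?_ hx1
  have := norm_le_norm_add_norm_sub' (S x) (T x)
  linarith [h x, add_mul (T.singularValues i) δ ‖x‖]

lemma norm_apply_le_singularValues_zero (T : E →ₗ[𝕜] F) (x : E) :
    ‖T x‖ ≤ T.singularValues 0 * ‖x‖ := by
  obtain ⟨v, hv⟩ := T.exists_orthonormalBasis_norm_sq rfl
  refine le_of_sq_le_sq ?_ (mul_nonneg (T.singularValues_nonneg _) (norm_nonneg _))
  rw [hv, mul_pow, ← v.sum_sq_norm_inner_right x, Finset.mul_sum]
  refine Finset.sum_le_sum fun j _ => ?_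
  gcongr
  · exact T.singularValues_nonneg j
  · exact T.singularValues_antitone (Nat.zero_le _)

lemma singularValues_mul_norm_le (T : E →ₗ[𝕜] F) (x : E) :
    T.singularValues (finrank 𝕜 E - 1) * ‖x‖ ≤ ‖T x‖ := by
  obtain ⟨v, hv⟩ := T.exists_orthonormalBasis_norm_sq rfl
  refine le_of_sq_le_sq ?_ (norm_nonneg _)
  rw [hv, mul_pow, ← v.sum_sq_norm_inner_right x, Finset.mul_sum]
  refine Finset.sum_le_sum fun j _ => ?_
  gcongr
  · exact T.singularValues_nonneg _
  · exact T.singularValues_antitone (by omega)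

/-- The last singular value of a map onto an `m`-dimensional space bounds the adjoint from below:
if it is positive, `T` maps the span of the first `m` right singular vectors onto the codomain. -/
lemma singularValues_mul_norm_le_norm_adjoint (T : E →ₗ[𝕜] F) {m : ℕ} (hm : finrank 𝕜 F = m)
    (y : F) : T.singularValues (m - 1) * ‖y‖ ≤ ‖adjoint T y‖ := by
  rcases (T.singularValues_nonneg (m - 1)).eq_or_lt with h0 | h0
  · rw [← h0, zero_mul]; exact norm_nonneg _
  rcases eq_or_ne y 0 with rfl | hy
  · simp
  have hy' : 0 < ‖y‖ := norm_pos_iff.mpr hy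
  have hm0 : 0 < m := by
    rw [← hm]; exact finrank_pos_iff_exists_ne_zero.mpr ⟨y, hy⟩
  obtain ⟨N, hN⟩ : ∃ N, finrank 𝕜 E = N := ⟨_, rfl⟩
  have hmN : m ≤ N := by
    by_contra hlt
    rw [T.singularValues_of_finrank_le (by omega)] at h0
    exact lt_irrefl _ h0
  obtain ⟨v, hv⟩ := T.exists_orthonormalBasis_norm_sq hN
  let Φ : EuclideanSpace 𝕜 (Fin m) →ₗ[𝕜] E :=
    { toFun := fun a => ∑ i, a i • v (Fin.castLE hmN i)
      map_add' := fun a b => by simp [add_smul, Finset.sum_add_distrib]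
      map_smul' := fun r a => by simp [Finset.smul_sum, smul_smul] }
  have hΦ : ∀ a, ∀ j : Fin N, m ≤ (j : ℕ) → inner 𝕜 (v j) (Φ a) = 0 := by
    intro a j hj
    change inner 𝕜 (v j) (∑ i, a i • v (Fin.castLE hmN i)) = 0
    rw [inner_sum]
    refine Finset.sum_eq_zero fun i _ => ?_
    rw [inner_smul_right, v.inner_eq_zero, mul_zero]
    intro h
    rw [h] at hj
    simp at hj
    omega
  have hlow : ∀ a, T.singularValues (m - 1) * ‖Φ a‖ ≤ ‖T (Φ a)‖ := by
    intro a
    refine le_of_sq_le_sq ?_ (norm_nonneg _)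
    rw [hv, mul_pow, ← v.sum_sq_norm_inner_right (Φ a), Finset.mul_sum]
    refine Finset.sum_le_sum fun j _ => ?_
    rcases lt_or_ge (j : ℕ) m with hj | hj
    · gcongr
      exact T.singularValues_antitone (by omega)
    · simp [hΦ a j hj]
  have hinj : Function.Injective (T ∘ₗ Φ) := by
    rw [injective_iff_map_eq_zero]
    intro a ha
    have h1 := hlow a
    rw [show T (Φ a) = 0 from ha, norm_zero] at h1
    have h2 : Φ a = 0 := by
      rw [← norm_eq_zero]
      exact le_antisymm (by nlinarith) (norm_nonneg _)
    ext i
    have h3 : inner 𝕜 (v (Fin.castLE hmN i)) (Φ a) = a i := by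
      change inner 𝕜 (v (Fin.castLE hmN i)) (∑ k, a k • v (Fin.castLE hmN k)) = a i
      rw [inner_sum, Finset.sum_eq_single i]
      · simp [inner_smul_right]
      · intro k _ hk
        rw [inner_smul_right, v.inner_eq_zero, mul_zero]
        intro h
        exact hk (Fin.castLE_injective hmN h).symm
      · simp
    rw [← h3, h2]; simp
  have hsurj : Function.Surjective (T ∘ₗ Φ) :=
    (injective_iff_surjective_of_finrank_eq_finrank (by simp [hm])).mp hinj
  obtain ⟨a, ha⟩ := hsurj y
  have h1 : ‖y‖ ^ 2 ≤ ‖Φ a‖ * ‖adjoint T y‖ := by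
    have h2 : inner 𝕜 (Φ a) (adjoint T y) = ((‖y‖ ^ 2 : ℝ) : 𝕜) := by
      rw [adjoint_inner_right, ← comp_apply, ha, inner_self_eq_norm_sq_to_K]; push_cast; rfl
    have h3 := norm_inner_le_norm (𝕜 := 𝕜) (Φ a) (adjoint T y)
    rw [h2, RCLike.norm_ofReal] at h3
    exact (le_abs_self _).trans h3
  have h4 : T.singularValues (m - 1) * ‖Φ a‖ ≤ ‖y‖ := by
    have := hlow a
    rwa [← comp_apply, ha] at this
  refine le_of_mul_le_mul_right ?_ hy'
  nlinarith [norm_nonneg (adjoint T y)]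

end LinearMap

namespace Prony

section SingularValues

variable {ι κ : Type*} [Fintype ι] [Fintype κ] [DecidableEq κ]

lemma sv_nonneg (M : Matrix ι κ ℂ) (i : ℕ) : 0 ≤ sv M i := LinearMap.singularValues_nonneg _ _

lemma sv_antitone (M : Matrix ι κ ℂ) : Antitone (sv M) := LinearMap.singularValues_antitone _

lemma sv_le_add (M M' : Matrix ι κ ℂ) (i : ℕ) : sv M i ≤ sv M' i + ‖M - M'‖ := by
  refine LinearMap.singularValues_le_add _ _ (norm_nonneg _) (fun x => ?_) i
  rw [← LinearMap.sub_apply, ← map_sub]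
  exact norm2_mulVec_le (M - M') (WithLp.ofLp x)

lemma norm2_mulVec_le_sv (M : Matrix ι κ ℂ) (x : κ → ℂ) : norm2 (M *ᵥ x) ≤ sv M 0 * norm2 x :=
  LinearMap.norm_apply_le_singularValues_zero (Matrix.toEuclideanLin M) (WithLp.toLp 2 x)

lemma norm2_conjTranspose_mulVec_le_sv (M : Matrix ι κ ℂ) (y : ι → ℂ) :
    norm2 (Mᴴ *ᵥ y) ≤ sv M 0 * norm2 y := by
  have h : norm2 (Mᴴ *ᵥ y) ^ 2 ≤ sv M 0 * norm2 y * norm2 (Mᴴ *ᵥ y) := by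
    have e : ((norm2 (Mᴴ *ᵥ y) ^ 2 : ℝ) : ℂ) = star y ⬝ᵥ (M *ᵥ (Mᴴ *ᵥ y)) := by
      rw [ofReal_norm2_sq, Matrix.star_mulVec, Matrix.conjTranspose_conjTranspose,
        ← Matrix.dotProduct_mulVec]
    have h2 := norm_dotProduct_le (star y) (M *ᵥ (Mᴴ *ᵥ y))
    rw [← e, norm2_star, Complex.norm_real, Real.norm_eq_abs] at h2
    refine (le_abs_self _).trans (h2.trans ?_)
    nlinarith [norm2_mulVec_le_sv M (Mᴴ *ᵥ y), norm2_nonneg y]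
  rcases (norm2_nonneg (Mᴴ *ᵥ y)).eq_or_lt with h0 | h0
  · rw [← h0]; exact mul_nonneg (sv_nonneg M 0) (norm2_nonneg y)
  · rw [sq] at h; exact le_of_mul_le_mul_right h h0

lemma sv_mul_norm2_le_conjTranspose (M : Matrix ι κ ℂ) (y : ι → ℂ) :
    sv M (Fintype.card ι - 1) * norm2 y ≤ norm2 (Mᴴ *ᵥ y) := by
  classical
  have h := LinearMap.singularValues_mul_norm_le_norm_adjoint (Matrix.toEuclideanLin M)
    (m := Fintype.card ι) (by simp) (WithLp.toLp 2 y)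
  rwa [← Matrix.toEuclideanLin_conjTranspose_eq_adjoint] at h

lemma norm2_transpose_mulVec_le_sv (M : Matrix ι κ ℂ) (y : ι → ℂ) :
    norm2 (Mᵀ *ᵥ y) ≤ sv M 0 * norm2 y := by
  rw [norm2_transpose_mulVec, ← norm2_star y]
  exact norm2_conjTranspose_mulVec_le_sv M _

lemma sv_mul_norm2_le_transpose (M : Matrix ι κ ℂ) (y : ι → ℂ) :
    sv M (Fintype.card ι - 1) * norm2 y ≤ norm2 (Mᵀ *ᵥ y) := by
  rw [norm2_transpose_mulVec, ← norm2_star y]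
  exact sv_mul_norm2_le_conjTranspose M _

lemma frobenius_le_sqrt_card_mul_sv (M : Matrix ι κ ℂ) : ‖M‖ ≤ √(Fintype.card ι) * sv M 0 := by
  classical
  have h := frobenius_mul_le_of_mulVec_le (sv_nonneg M 0) (norm2_transpose_mulVec_le_sv M)
    (1 : Matrix ι ι ℂ)
  rwa [Matrix.mul_one, Matrix.frobenius_norm_transpose, frobenius_one, mul_comm] at h

lemma sv_pos_iff (M : Matrix ι κ ℂ) (i : ℕ) : 0 < sv M i ↔ i < M.rank := by
  rw [sv, LinearMap.singularValues_pos_iff_lt_finrank_range,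
    Matrix.rank_eq_finrank_range_toLin M (PiLp.basisFun 2 ℂ ι) (PiLp.basisFun 2 ℂ κ)]
  rw [Matrix.toEuclideanLin, Matrix.toLpLin_eq_toLin]

lemma sv_eq_zero_of_rank_le {M : Matrix ι κ ℂ} {i : ℕ} (h : M.rank ≤ i) : sv M i = 0 :=
  le_antisymm (not_lt.mp fun h' => absurd ((sv_pos_iff M i).mp h') (not_lt.mpr h)) (sv_nonneg M i)

lemma svMin_square [DecidableEq ι] (M : Matrix ι ι ℂ) : svMin M = sv M (Fintype.card ι - 1) := by
  rw [svMin, min_self]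

lemma svMin_mul_norm2_le [DecidableEq ι] (M : Matrix ι ι ℂ) (x : ι → ℂ) :
    svMin M * norm2 x ≤ norm2 (M *ᵥ x) := by
  have h := LinearMap.singularValues_mul_norm_le (Matrix.toEuclideanLin M) (WithLp.toLp 2 x)
  rw [finrank_euclideanSpace] at h
  rwa [svMin_square]

lemma svMin_pos_of_isUnit [DecidableEq ι] [Nonempty ι] {M : Matrix ι ι ℂ} (h : IsUnit M) :
    0 < svMin M := by
  rw [svMin_square, sv_pos_iff, Matrix.rank_of_isUnit M h]
  exact Nat.sub_lt Fintype.card_pos one_pos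

lemma isUnit_of_rank_eq_card [DecidableEq ι] {M : Matrix ι ι ℂ} (h : M.rank = Fintype.card ι) :
    IsUnit M := by
  rcases isEmpty_or_nonempty ι with hι | hι
  · exact isUnit_of_subsingleton M
  · refine isUnit_of_norm2_lower_bound ?_ (svMin_mul_norm2_le M)
    rw [svMin_square, sv_pos_iff, h]
    exact Nat.sub_lt Fintype.card_pos one_pos

lemma one_le_cond2 {M : Matrix ι κ ℂ} (h : 0 < svMin M) : 1 ≤ cond2 M := by
  rw [cond2, one_le_div h]
  exact sv_antitone M (Nat.zero_le _)

lemma cond2_nonneg (M : Matrix ι κ ℂ) : 0 ≤ cond2 M := div_nonneg (sv_nonneg _ _) (sv_nonneg _ _)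

lemma svMin_of_rank_eq_card {M : Matrix ι κ ℂ} (h : M.rank = Fintype.card ι) :
    svMin M = sv M (Fintype.card ι - 1) := by
  have : M.rank ≤ Fintype.card κ := Matrix.rank_le_card_width M
  rw [svMin, min_eq_left (h ▸ this)]

end SingularValues

/-! ### Least squares -/

section LeastSquares

variable {ι κ : Type*} [Fintype ι] [Fintype κ]

/-- The residual of a minimizer is orthogonal to the range, so the error in the range is an
orthogonal projection of the residual at any other point. -/
lemma IsLeastSquares.norm2_mulVec_sub_le {B : Matrix ι κ ℂ} {b : ι → ℂ} {x : κ → ℂ}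
    (h : IsLeastSquares B b x) (y : κ → ℂ) : norm2 (B *ᵥ (x - y)) ≤ norm2 (b - B *ᵥ y) := by
  set r : EuclideanSpace ℂ ι := WithLp.toLp 2 (B *ᵥ x - b) with hr
  set w : EuclideanSpace ℂ ι := WithLp.toLp 2 (B *ᵥ (x - y)) with hw
  have hmin : ∀ s : ℝ, ‖r‖ ≤ ‖r - (s : ℂ) • w‖ := fun s => by
    have h1 := h (x - (s : ℂ) • (x - y))
    rw [Matrix.mulVec_sub, Matrix.mulVec_smul] at h1
    have e : r - (s : ℂ) • w = WithLp.toLp 2 (B *ᵥ x - (s : ℂ) • B *ᵥ (x - y) - b) := by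
      rw [hr, hw, ← WithLp.toLp_smul, ← WithLp.toLp_sub]
      congr 1
      abel
    rw [e]
    exact h1
  have hq : norm2 (b - B *ᵥ y) = ‖r - w‖ := by
    rw [norm2, ← norm_neg, hr, hw, ← WithLp.toLp_sub, ← WithLp.toLp_neg]
    congr 2
    rw [Matrix.mulVec_sub]
    abel
  change ‖w‖ ≤ _
  rw [hq]
  rcases (norm_nonneg w).eq_or_lt with h0 | h0
  · rw [← h0]; exact norm_nonneg _
  have hre : RCLike.re (inner ℂ r w) ≤ 0 := by
    by_contra hpos
    push Not at hpos
    set ρ := RCLike.re (inner ℂ r w)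
    -- the step that minimizes `‖r - s w‖`
    have h1 := pow_le_pow_left₀ (norm_nonneg _) (hmin (ρ / ‖w‖ ^ 2)) 2
    rw [norm_sub_sq (𝕜 := ℂ), inner_smul_right, norm_smul, Complex.norm_real,
      RCLike.re_to_complex, Complex.re_ofReal_mul, mul_pow, Real.norm_eq_abs, sq_abs] at h1
    change _ ≤ ‖r‖ ^ 2 - 2 * (ρ / ‖w‖ ^ 2 * ρ) + (ρ / ‖w‖ ^ 2) ^ 2 * ‖w‖ ^ 2 at h1
    have e : (ρ / ‖w‖ ^ 2) ^ 2 * ‖w‖ ^ 2 = ρ / ‖w‖ ^ 2 * ρ := by field_simp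
    rw [e] at h1
    have : 0 < ρ / ‖w‖ ^ 2 * ρ := by positivity
    linarith
  refine le_of_sq_le_sq ?_ (norm_nonneg _)
  rw [norm_sub_sq (𝕜 := ℂ)]
  nlinarith [sq_nonneg ‖r‖]

variable [DecidableEq κ]

/-- Forward error of the least squares problem `Aᵀ x = b` with a consistent exact right-hand side,
under a relative perturbation `ζ` of `A` and `√m ζ` of `b`. -/
lemma IsLeastSquares.forward_error {A A' : Matrix ι κ ℂ} {b' : κ → ℂ} {c c' : ι → ℂ} {ζ : ℝ}
    (hA : A.rank = Fintype.card ι) (hζ : ‖A' - A‖ ≤ ζ * ‖A‖)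
    (hb : norm2 (b' - Aᵀ *ᵥ c) ≤ √(Fintype.card ι) * ζ * norm2 (Aᵀ *ᵥ c)) (hζ0 : 0 ≤ ζ)
    (h : IsLeastSquares A'ᵀ b' c') :
    norm2 (c' - c) * (1 - cond2 A * √(Fintype.card ι) * ζ) ≤
      2 * (cond2 A * √(Fintype.card ι) * ζ) * norm2 c := by
  rcases isEmpty_or_nonempty ι with hι | hι
  · have h1 : ∀ v : ι → ℂ, norm2 v = 0 := fun v => norm2_eq_zero.mpr (Subsingleton.elim _ _)
    simp [h1]
  set m := Fintype.card ι
  have hs : 0 < svMin A := by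
    rw [svMin_of_rank_eq_card hA, sv_pos_iff, hA]
    exact Nat.sub_lt Fintype.card_pos one_pos
  have hx' : cond2 A * √(m : ℝ) * ζ * svMin A = √m * ζ * sv A 0 := by
    rw [cond2]; field_simp
  set x := cond2 A * √(m : ℝ) * ζ
  set a := norm2 (c' - c)
  have hE : ‖(A' - A)ᵀ‖ ≤ √m * ζ * sv A 0 := by
    rw [Matrix.frobenius_norm_transpose]
    refine hζ.trans ?_
    have := mul_le_mul_of_nonneg_left (frobenius_le_sqrt_card_mul_sv A) hζ0
    linarith
  have hE' : ∀ v, norm2 ((A' - A)ᵀ *ᵥ v) ≤ √m * ζ * sv A 0 * norm2 v := fun v =>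
    (norm2_mulVec_le _ v).trans (mul_le_mul_of_nonneg_right hE (norm2_nonneg v))
  have h1 : svMin A * a ≤ norm2 (A'ᵀ *ᵥ (c' - c)) + √m * ζ * sv A 0 * a := by
    rw [svMin_of_rank_eq_card hA]
    refine (sv_mul_norm2_le_transpose A (c' - c)).trans ?_
    have e : Aᵀ *ᵥ (c' - c) = A'ᵀ *ᵥ (c' - c) - (A' - A)ᵀ *ᵥ (c' - c) := by
      rw [Matrix.transpose_sub, Matrix.sub_mulVec]; abel
    rw [e]
    exact (norm2_sub_le _ _).trans (by gcongr; exact hE' _)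
  have h2 : norm2 (A'ᵀ *ᵥ (c' - c)) ≤ 2 * (√m * ζ * sv A 0) * norm2 c := by
    refine (h.norm2_mulVec_sub_le c).trans ?_
    have e : b' - A'ᵀ *ᵥ c = (b' - Aᵀ *ᵥ c) - (A' - A)ᵀ *ᵥ c := by
      rw [Matrix.transpose_sub, Matrix.sub_mulVec]; abel
    rw [e]
    refine (norm2_sub_le _ _).trans ?_
    have h3 : √m * ζ * norm2 (Aᵀ *ᵥ c) ≤ √m * ζ * (sv A 0 * norm2 c) :=
      mul_le_mul_of_nonneg_left (norm2_transpose_mulVec_le_sv A c) (by positivity)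
    linarith [hE' c]
  rw [← hx'] at h1 h2
  refine le_of_mul_le_mul_right (a := svMin A) ?_ hs
  linarith

end LeastSquares

/-! ### Perturbation of a diagonal matrix -/

section Eigen

variable {ι : Type*} [Fintype ι] [DecidableEq ι]

lemma norm2_sq_eq_add_update (Y : ι → ℂ) (p : ι) :
    norm2 Y ^ 2 = ‖Y p‖ ^ 2 + norm2 (Function.update Y p 0) ^ 2 := by
  rw [norm2_sq, norm2_sq, ← Finset.add_sum_erase _ _ (Finset.mem_univ p),
    ← Finset.add_sum_erase (a := p) _ (fun i => ‖Function.update Y p 0 i‖ ^ 2) (Finset.mem_univ p)]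
  simp only [Function.update_self, norm_zero, ne_eq, OfNat.ofNat_ne_zero, not_false_eq_true,
    zero_pow, zero_add]
  congr 1
  refine Finset.sum_congr rfl fun i hi => ?_
  rw [Function.update_of_ne (Finset.ne_of_mem_erase hi)]

/-- A vector with `(dⱼ - ν) Yⱼ = -Vⱼ`, where `V` is small and only `d_p` is near `ν`, is
concentrated in the entry `p`. -/
lemma norm2_update_le {d Y V : ι → ℂ} {ν : ℂ} {g h : ℝ} (hg : 0 < g) {p : ι}
    (hd : ∀ j, j ≠ p → g / 2 ≤ ‖d j - ν‖) (hY : ∀ j, (d j - ν) * Y j = -V j)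
    (hV : norm2 V ≤ h * norm2 Y) : norm2 (Function.update Y p 0) ≤ 2 * h / g * norm2 Y := by
  have h1 : norm2 (Function.update Y p 0) ≤ 2 / g * norm2 V := by
    refine norm2_le_of_sq_le (by have := norm2_nonneg V; positivity) ?_
    rw [mul_pow, norm2_sq, Finset.mul_sum]
    refine Finset.sum_le_sum fun j _ => ?_
    rcases eq_or_ne j p with rfl | hj
    · rw [Function.update_self, norm_zero, zero_pow two_ne_zero]; positivity
    · rw [Function.update_of_ne hj, ← mul_pow]
      refine pow_le_pow_left₀ (norm_nonneg _) ?_ 2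
      have h2 : ‖d j - ν‖ * ‖Y j‖ = ‖V j‖ := by rw [← norm_mul, hY, norm_neg]
      have h3 := mul_le_mul_of_nonneg_right (hd j hj) (norm_nonneg (Y j))
      rw [div_mul_eq_mul_div, le_div_iff₀ hg]
      linarith
  refine h1.trans ?_
  calc 2 / g * norm2 V ≤ 2 / g * (h * norm2 Y) := by gcongr
    _ = 2 * h / g * norm2 Y := by ring

omit [DecidableEq ι] in
/-- Bauer–Fike for a diagonal matrix. -/
lemma exists_norm_sub_le_of_eigenvector {lam Y V : ι → ℂ} {ν : ℂ} {h : ℝ}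
    (hY : ∀ j, (lam j - ν) * Y j = -V j) (hV : norm2 V ≤ h * norm2 Y) (hY0 : Y ≠ 0) :
    ∃ p, ‖lam p - ν‖ ≤ h := by
  by_contra! hcon
  obtain ⟨q, hq⟩ := Function.ne_iff.mp hY0
  have h0 : 0 ≤ h := by
    have h1 : 0 < norm2 Y := (norm2_nonneg Y).lt_of_ne' fun h => hY0 (norm2_eq_zero.mp h)
    by_contra! hneg
    nlinarith [norm2_nonneg V]
  have h1 : (h * norm2 Y) ^ 2 < norm2 V ^ 2 := by
    rw [mul_pow, norm2_sq, norm2_sq, Finset.mul_sum]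
    have hle : ∀ j, h ^ 2 * ‖Y j‖ ^ 2 ≤ ‖V j‖ ^ 2 := fun j => by
      rw [← norm_neg (V j), ← hY, norm_mul, mul_pow]
      have := (hcon j).le
      gcongr
    refine Finset.sum_lt_sum (fun j _ => hle j) ⟨q, Finset.mem_univ q, ?_⟩
    rw [← norm_neg (V q), ← hY, norm_mul, mul_pow]
    have hq' : 0 < ‖Y q‖ ^ 2 := by
      have : 0 < ‖Y q‖ := norm_pos_iff.mpr hq
      positivity
    exact mul_lt_mul_of_pos_right (pow_lt_pow_left₀ (hcon q) h0 two_ne_zero) hq'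
  exact absurd (pow_le_pow_left₀ (norm2_nonneg V) hV 2) (not_le.mpr h1)

/-- First-order perturbation of a diagonal matrix with separated entries. A left and a right
eigenvector `X`, `Y` of `diag lam + H` are both concentrated in one entry `p`, so a compression
`X (diag z + P) Y` is `z p` up to `P` and an error that is quadratic in `H`. -/
lemma exists_eigenpair_near {lam : ι → ℂ} {H : Matrix ι ι ℂ} {g h : ℝ} (hg : 0 < g)
    (hsep : ∀ i j, i ≠ j → g ≤ ‖lam i - lam j‖) (hH : ‖H‖ ≤ h) (hhg : h ≤ g / 8)
    {X Y : ι → ℂ} {ν : ℂ} (hX : X ᵥ* (Matrix.diagonal lam + H) = ν • X)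
    (hY : (Matrix.diagonal lam + H) *ᵥ Y = ν • Y) (hXY : X ⬝ᵥ Y = 1) :
    ∃ p, ‖lam p - ν‖ ≤ h ∧ ∀ (z : ι → ℂ) (P : Matrix ι ι ℂ), (∀ j, ‖z j‖ ≤ 1) →
      ‖X ⬝ᵥ ((Matrix.diagonal z + P) *ᵥ Y) - z p‖ ≤ 16 * h ^ 2 / g ^ 2 + 2 * ‖P‖ := by
  have h0 : 0 ≤ h := (norm_nonneg H).trans hH
  have hY1 : ∀ j, (lam j - ν) * Y j = -(H *ᵥ Y) j := fun j => by
    have := congrFun hY j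
    rw [Matrix.add_mulVec, Pi.add_apply, Matrix.mulVec_diagonal, Pi.smul_apply,
      smul_eq_mul] at this
    linear_combination this
  have hX1 : ∀ j, (lam j - ν) * X j = -(Hᵀ *ᵥ X) j := fun j => by
    have := congrFun hX j
    rw [Matrix.vecMul_add, Pi.add_apply, Matrix.vecMul_diagonal, Pi.smul_apply,
      smul_eq_mul, ← Matrix.mulVec_transpose] at this
    linear_combination this
  have hYV : norm2 (H *ᵥ Y) ≤ h * norm2 Y :=
    (norm2_mulVec_le H Y).trans (mul_le_mul_of_nonneg_right hH (norm2_nonneg Y))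
  have hXV : norm2 (Hᵀ *ᵥ X) ≤ h * norm2 X :=
    (norm2_mulVec_le Hᵀ X).trans (mul_le_mul_of_nonneg_right
      (by rwa [Matrix.frobenius_norm_transpose]) (norm2_nonneg X))
  have hY0 : Y ≠ 0 := fun h => by simp [h] at hXY
  obtain ⟨p, hp⟩ := exists_norm_sub_le_of_eigenvector hY1 hYV hY0
  have hd : ∀ j, j ≠ p → g / 2 ≤ ‖lam j - ν‖ := fun j hj => by
    have h1 := norm_sub_le (lam j - ν) (lam p - ν)
    rw [sub_sub_sub_cancel_right] at h1
    linarith [hsep j p hj]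
  refine ⟨p, hp, fun z P hz => ?_⟩
  set a := 2 * h / g with ha
  have ha0 : 0 ≤ a := by positivity
  have ha1 : a ≤ 1 / 4 := by rw [ha, div_le_iff₀ hg]; linarith
  have hYo := norm2_update_le hg hd hY1 hYV
  have hXo := norm2_update_le hg hd hX1 hXV
  have hYs := norm2_sq_eq_add_update Y p
  have hXs := norm2_sq_eq_add_update X p
  set Xo := Function.update X p 0 with hXodef
  set Yo := Function.update Y p 0 with hYodef
  have nX := norm2_nonneg X
  have nY := norm2_nonneg Y
  have hoff : norm2 Xo * norm2 Yo ≤ a ^ 2 * (norm2 X * norm2 Y) := by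
    calc norm2 Xo * norm2 Yo ≤ (a * norm2 X) * (a * norm2 Y) :=
          mul_le_mul hXo hYo (norm2_nonneg _) (by positivity)
      _ = _ := by ring
  have hsplit : ∀ w : ι → ℂ, ∑ j, X j * (w j * Y j) =
      X p * (w p * Y p) + Xo ⬝ᵥ (Matrix.diagonal w *ᵥ Yo) := fun w => by
    rw [dotProduct, ← Finset.add_sum_erase _ _ (Finset.mem_univ p),
      ← Finset.add_sum_erase (a := p) _ (fun j => Xo j * (Matrix.diagonal w *ᵥ Yo) j)
        (Finset.mem_univ p)]
    rw [hXodef, Function.update_self, zero_mul, zero_add]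
    congr 1
    refine Finset.sum_congr rfl fun i hi => ?_
    rw [Matrix.mulVec_diagonal, hYodef, Function.update_of_ne (Finset.ne_of_mem_erase hi),
      Function.update_of_ne (Finset.ne_of_mem_erase hi)]
  -- the product of the lengths of `X` and `Y` is nearly one
  have hprod : norm2 X * norm2 Y ≤ 2 := by
    have h1 := hsplit 1
    simp only [Pi.one_apply, one_mul] at h1
    rw [show ∑ j, X j * Y j = 1 from hXY, Matrix.diagonal_one', Matrix.one_mulVec] at h1
    have h2 : ‖X p‖ * ‖Y p‖ ≤ 1 + a ^ 2 * (norm2 X * norm2 Y) := by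
      rw [← norm_mul, show X p * Y p = 1 - Xo ⬝ᵥ Yo by rw [h1]; ring]
      refine (norm_sub_le _ _).trans ?_
      rw [norm_one]
      linarith [norm_dotProduct_le Xo Yo]
    have hYp : (1 - a ^ 2) * norm2 Y ^ 2 ≤ ‖Y p‖ ^ 2 := by
      have := pow_le_pow_left₀ (norm2_nonneg _) hYo 2
      rw [mul_pow] at this
      linarith
    have hXp : (1 - a ^ 2) * norm2 X ^ 2 ≤ ‖X p‖ ^ 2 := by
      have := pow_le_pow_left₀ (norm2_nonneg _) hXo 2
      rw [mul_pow] at this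
      linarith
    have ha2 : a ^ 2 ≤ 1 / 16 := by nlinarith
    have h3 : (1 - a ^ 2) * (norm2 X * norm2 Y) ≤ ‖X p‖ * ‖Y p‖ := by
      refine le_of_sq_le_sq ?_ (by positivity)
      have := mul_le_mul hXp hYp (mul_nonneg (by linarith) (sq_nonneg _)) (sq_nonneg _)
      calc ((1 - a ^ 2) * (norm2 X * norm2 Y)) ^ 2
          = (1 - a ^ 2) * norm2 X ^ 2 * ((1 - a ^ 2) * norm2 Y ^ 2) := by ring
        _ ≤ _ := this
        _ = _ := by ring
    nlinarith [mul_nonneg nX nY]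
  have hmain : X ⬝ᵥ ((Matrix.diagonal z + P) *ᵥ Y) - z p =
      Xo ⬝ᵥ (Matrix.diagonal (fun j => z j - z p) *ᵥ Yo) + X ⬝ᵥ (P *ᵥ Y) := by
    have h1 := hsplit fun j => z j - z p
    simp only [sub_self, zero_mul, mul_zero, zero_add] at h1
    rw [← h1, Matrix.add_mulVec, dotProduct_add]
    have h2 : X ⬝ᵥ (Matrix.diagonal z *ᵥ Y) = ∑ j, X j * (z j * Y j) := by
      simp only [dotProduct, Matrix.mulVec_diagonal]
    have h3 : ∑ j, X j * ((z j - z p) * Y j) = ∑ j, X j * (z j * Y j) - z p * (X ⬝ᵥ Y) := by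
      rw [dotProduct, Finset.mul_sum, ← Finset.sum_sub_distrib]
      exact Finset.sum_congr rfl fun j _ => by ring
    rw [h2, h3, hXY]
    ring
  rw [hmain]
  refine (norm_add_le _ _).trans (add_le_add ?_ ?_)
  · refine (norm_dotProduct_le _ _).trans ?_
    have h1 : norm2 (Matrix.diagonal (fun j => z j - z p) *ᵥ Yo) ≤ 2 * norm2 Yo :=
      norm2_diagonal_mulVec_le zero_le_two (fun j => (norm_sub_le _ _).trans
        (by linarith [hz j, hz p])) _
    calc _ ≤ norm2 Xo * (2 * norm2 Yo) := by gcongr; exact norm2_nonneg _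
      _ ≤ 2 * (a ^ 2 * (norm2 X * norm2 Y)) := by linarith
      _ ≤ 2 * (a ^ 2 * 2) := by gcongr
      _ = 16 * h ^ 2 / g ^ 2 := by rw [ha]; ring
  · refine (norm_dotProduct_le _ _).trans ?_
    calc _ ≤ norm2 X * (‖P‖ * norm2 Y) := by gcongr; exact norm2_mulVec_le _ _
      _ = norm2 X * norm2 Y * ‖P‖ := by ring
      _ ≤ 2 * ‖P‖ := by gcongr

end Eigen

/-! ### Perturbation of monomials -/

lemma norm_prod_sub_prod_le {ι : Type*} (s : Finset ι) {a b : ι → ℂ} {α : ι → ℝ}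
    (hb : ∀ i ∈ s, ‖b i‖ ≤ 1) (hab : ∀ i ∈ s, ‖a i - b i‖ ≤ α i - 1) :
    ‖∏ i ∈ s, a i - ∏ i ∈ s, b i‖ ≤ ∏ i ∈ s, α i - 1 := by
  classical
  induction s using Finset.induction_on with
  | empty => simp
  | insert j s hj ih =>
    rw [Finset.prod_insert hj, Finset.prod_insert hj, Finset.prod_insert hj]
    have ih' := ih (fun i hi => hb i (Finset.mem_insert_of_mem hi))
      (fun i hi => hab i (Finset.mem_insert_of_mem hi))
    have hj1 := hb j (Finset.mem_insert_self j s)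
    have hj2 := hab j (Finset.mem_insert_self j s)
    have hP : ‖∏ i ∈ s, b i‖ ≤ 1 := by
      rw [norm_prod]
      exact Finset.prod_le_one (fun _ _ => norm_nonneg _)
        (fun i hi => hb i (Finset.mem_insert_of_mem hi))
    have ha : ‖a j‖ ≤ α j := by
      have := norm_le_norm_add_norm_sub' (a j) (b j)
      linarith
    have hα : 0 ≤ α j := (norm_nonneg _).trans ha
    have e : a j * ∏ i ∈ s, a i - b j * ∏ i ∈ s, b i =
        a j * (∏ i ∈ s, a i - ∏ i ∈ s, b i) + (a j - b j) * ∏ i ∈ s, b i := by ring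
    rw [e]
    refine (norm_add_le _ _).trans ?_
    rw [norm_mul, norm_mul]
    have h1 := mul_le_mul ha ih' (norm_nonneg _) hα
    have h2 := mul_le_mul hj2 hP (norm_nonneg _) ((norm_nonneg _).trans hj2)
    linarith

lemma norm_nodeMatrix_entry_sub_le {d m n : ℕ} {z z' : Fin m → Fin d → ℂ} {j i : Fin m} {e : ℝ}
    (he : 0 ≤ e) (hz : ∀ l, ‖z i l‖ ≤ 1) (hzz : ∀ l, ‖z' j l - z i l‖ ≤ e)
    (hne : n * d * e ≤ 1) (k : Grid d n) :
    ‖nodeMatrix n z' j k - nodeMatrix n z i k‖ ≤ 2 * (n * d * e) := by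
  have hpow : ∀ l, ‖z' j l ^ (k l : ℕ) - z i l ^ (k l : ℕ)‖ ≤ (1 + e) ^ n - 1 := fun l => by
    have h1 := norm_prod_sub_prod_le (Finset.range (k l : ℕ)) (a := fun _ => z' j l)
      (b := fun _ => z i l) (α := fun _ => 1 + e) (fun _ _ => hz l)
      (fun _ _ => by linarith [hzz l])
    simp only [Finset.prod_const, Finset.card_range] at h1
    refine h1.trans (sub_le_sub_right (pow_le_pow_right₀ (by linarith) ?_) 1)
    exact Nat.lt_succ_iff.mp (k l).isLt
  have h2 := norm_prod_sub_prod_le Finset.univ (a := fun l => z' j l ^ (k l : ℕ))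
    (b := fun l => z i l ^ (k l : ℕ)) (α := fun _ => (1 + e) ^ n)
    (fun l _ => by rw [norm_pow]; exact pow_le_one₀ (norm_nonneg _) (hz l)) (fun l _ => hpow l)
  simp only [Finset.prod_const, Finset.card_univ, Fintype.card_fin] at h2
  refine h2.trans ?_
  rw [← pow_mul]
  have h3 : (1 + e) ^ (n * d) ≤ Real.exp (n * d * e) := by
    have := pow_le_pow_left₀ (by positivity) ((add_comm 1 e).trans_le (Real.add_one_le_exp e))
      (n * d)
    rwa [← Real.exp_nat_mul, Nat.cast_mul] at this
  have h4 : 0 ≤ n * d * e := by positivity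
  have h5 := Real.abs_exp_sub_one_le (x := n * d * e) (by rwa [abs_of_nonneg h4])
  rw [abs_of_nonneg h4] at h5
  linarith [le_abs_self (Real.exp (n * d * e) - 1)]

/-! ### Dominant singular vectors -/

section DominantSVD

variable {ι : Type*} [Fintype ι] [DecidableEq ι] {m : ℕ}

omit [DecidableEq ι] in
lemma fromCols_isometry_iff {κ ν : Type*} [Fintype κ] [Fintype ν] [DecidableEq κ]
    [DecidableEq ν] {U : Matrix ι κ ℂ} {U' : Matrix ι ν ℂ} :
    (Matrix.fromCols U U')ᴴ * Matrix.fromCols U U' = 1 ↔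
      Uᴴ * U = 1 ∧ Uᴴ * U' = 0 ∧ U'ᴴ * U = 0 ∧ U'ᴴ * U' = 1 := by
  rw [Matrix.conjTranspose_fromCols_eq_fromRows_conjTranspose, Matrix.fromRows_mul_fromCols,
    ← Matrix.fromBlocks_one, Matrix.fromBlocks_inj]

lemma norm2_le_add_of_fromCols {U : Matrix ι (Fin m) ℂ}
    {U' : Matrix ι (Fin (Fintype.card ι - m)) ℂ} (hm : m ≤ Fintype.card ι)
    (h : (Matrix.fromCols U U')ᴴ * Matrix.fromCols U U' = 1) (y : ι → ℂ) :
    norm2 y ≤ norm2 (Uᴴ *ᵥ y) + norm2 (U'ᴴ *ᵥ y) := by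
  obtain ⟨h1, -, -, h4⟩ := fromCols_isometry_iff.mp h
  have hcomm := (Matrix.mul_eq_one_comm_of_card_eq _ _ _
    (by rw [Fintype.card_sum, Fintype.card_fin, Fintype.card_fin]; omega)).mp h
  rw [Matrix.conjTranspose_fromCols_eq_fromRows_conjTranspose, Matrix.fromCols_mul_fromRows]
    at hcomm
  have e : y = U *ᵥ (Uᴴ *ᵥ y) + U' *ᵥ (U'ᴴ *ᵥ y) := by
    rw [Matrix.mulVec_mulVec, Matrix.mulVec_mulVec, ← Matrix.add_mulVec, hcomm, Matrix.one_mulVec]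
  calc norm2 y = norm2 (U *ᵥ (Uᴴ *ᵥ y) + U' *ᵥ (U'ᴴ *ᵥ y)) := by rw [← e]
    _ ≤ _ := (norm2_add_le _ _).trans_eq
      (by rw [norm2_mulVec_of_isometry h1, norm2_mulVec_of_isometry h4])

lemma IsDominantSVD.left_isometry {M : Matrix ι ι ℂ} {U V : Matrix ι (Fin m) ℂ}
    (h : IsDominantSVD M U V) : Uᴴ * U = 1 := by
  obtain ⟨U', V', hU, -, -⟩ := h
  exact (fromCols_isometry_iff.mp hU).1

lemma IsDominantSVD.right_isometry {M : Matrix ι ι ℂ} {U V : Matrix ι (Fin m) ℂ}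
    (h : IsDominantSVD M U V) : Vᴴ * V = 1 := by
  obtain ⟨U', V', -, hV, -⟩ := h
  exact (fromCols_isometry_iff.mp hV).1

lemma IsDominantSVD.conjTranspose_mul_mul {M : Matrix ι ι ℂ} {U V : Matrix ι (Fin m) ℂ}
    (h : IsDominantSVD M U V) : Uᴴ * M * V = svDiag m M := by
  obtain ⟨U', V', hU, hV, hM⟩ := h
  obtain ⟨h1, h2, -, -⟩ := fromCols_isometry_iff.mp hU
  obtain ⟨h3, -, h4, -⟩ := fromCols_isometry_iff.mp hV
  generalize svDiag m M = S at hM ⊢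
  generalize Matrix.diagonal (fun j : Fin (Fintype.card ι - m) => (sv M (m + j) : ℂ)) = S' at hM
  rw [hM, Matrix.mul_add, Matrix.add_mul]
  have e1 : Uᴴ * (U * S * Vᴴ) * V = (Uᴴ * U) * S * (Vᴴ * V) := by simp only [Matrix.mul_assoc]
  have e2 : Uᴴ * (U' * S' * V'ᴴ) * V = (Uᴴ * U') * S' * (V'ᴴ * V) := by
    simp only [Matrix.mul_assoc]
  rw [e1, e2, h1, h2, h3, h4]
  simp

lemma IsDominantSVD.eq_reduced {M : Matrix ι ι ℂ} {U V : Matrix ι (Fin m) ℂ}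
    (h : IsDominantSVD M U V) (hr : M.rank = m) : M = U * svDiag m M * Vᴴ := by
  obtain ⟨U', V', -, -, hM⟩ := h
  have h0 : (fun j : Fin (Fintype.card ι - m) => (sv M (m + j) : ℂ)) = fun _ => 0 := by
    ext j
    rw [sv_eq_zero_of_rank_le (by omega), Complex.ofReal_zero]
  rw [h0, Matrix.diagonal_zero, Matrix.mul_zero, Matrix.zero_mul, add_zero] at hM
  exact hM

lemma norm_sv_inv_le {M : Matrix ι ι ℂ} {s : ℝ} (hs : 0 < s) (h : s ≤ sv M (m - 1)) (i : Fin m) :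
    ‖((sv M i : ℂ))⁻¹‖ ≤ s⁻¹ := by
  rw [norm_inv, Complex.norm_real, Real.norm_of_nonneg (sv_nonneg M i)]
  exact inv_anti₀ hs (h.trans (sv_antitone M (by omega)))

lemma svDiag_inv {M : Matrix ι ι ℂ} (h : 0 < sv M (m - 1)) :
    (svDiag m M)⁻¹ = Matrix.diagonal fun i : Fin m => ((sv M i : ℂ))⁻¹ := by
  refine Matrix.inv_eq_right_inv ?_
  rw [svDiag, Matrix.diagonal_mul_diagonal, ← Matrix.diagonal_one]
  congr 1
  ext i
  have : 0 < sv M i := h.trans_le (sv_antitone M (by omega))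
  exact mul_inv_cancel₀ (by exact_mod_cast this.ne')

lemma isUnit_det_svDiag {M : Matrix ι ι ℂ} (h : 0 < sv M (m - 1)) : IsUnit (svDiag m M).det := by
  rw [svDiag, Matrix.det_diagonal, isUnit_iff_ne_zero, Finset.prod_ne_zero_iff]
  intro i _
  have : 0 < sv M i := h.trans_le (sv_antitone M (by omega))
  exact_mod_cast this.ne'

lemma frobenius_svDiag_inv_mul_le {κ : Type*} [Fintype κ] {M : Matrix ι ι ℂ}
    (h : 0 < sv M (m - 1)) (P : Matrix (Fin m) κ ℂ) :
    ‖(svDiag m M)⁻¹ * P‖ ≤ (sv M (m - 1))⁻¹ * ‖P‖ := by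
  rw [svDiag_inv h]
  exact frobenius_diagonal_mul_le (by positivity) (norm_sv_inv_le h le_rfl) P

/-- The dominant left singular spaces of nearby matrices are nearby: the complementary singular
vectors `U'` of `M'` satisfy `U'ᴴ U = U'ᴴ M V Σ⁻¹`, which is small because both `U'ᴴ M'` and
`M - M'` are. -/
lemma IsDominantSVD.half_norm2_le {M M' : Matrix ι ι ℂ} {U V U₁ V₁ : Matrix ι (Fin m) ℂ}
    (h : IsDominantSVD M U V) (hr : M.rank = m) (h' : IsDominantSVD M' U₁ V₁)
    (hM : ‖M' - M‖ ≤ sv M (m - 1) / 4) (x : Fin m → ℂ) :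
    1 / 2 * norm2 x ≤ norm2 ((U₁ᴴ * U) *ᵥ x) := by
  rcases Nat.eq_zero_or_pos m with rfl | hm0
  · rw [norm2_eq_zero.mpr (Subsingleton.elim x 0), mul_zero]; exact norm2_nonneg _
  have hs : 0 < sv M (m - 1) := by rw [sv_pos_iff, hr]; omega
  have hmN : m ≤ Fintype.card ι := hr ▸ Matrix.rank_le_card_width M
  have hU := h.left_isometry
  have hV := h.right_isometry
  have hMUV := h.eq_reduced hr
  obtain ⟨U₂, V₂, hU₂, hV₂, hM'⟩ := h'
  obtain ⟨-, -, h21, h22⟩ := fromCols_isometry_iff.mp hU₂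
  obtain ⟨-, -, -, k22⟩ := fromCols_isometry_iff.mp hV₂
  set s := sv M (m - 1) with hsdef
  have hdecomp := norm2_le_add_of_fromCols hmN hU₂ (U *ᵥ x)
  rw [norm2_mulVec_of_isometry hU, Matrix.mulVec_mulVec, Matrix.mulVec_mulVec] at hdecomp
  set D := Matrix.diagonal (fun j : Fin (Fintype.card ι - m) => (sv M' (m + j) : ℂ)) with hD
  have hUM' : U₂ᴴ * M' = D * V₂ᴴ := by
    generalize svDiag m M' = S at hM'
    rw [hM', Matrix.mul_add]
    have e1 : U₂ᴴ * (U₁ * S * V₁ᴴ) = (U₂ᴴ * U₁) * S * V₁ᴴ := by simp only [Matrix.mul_assoc]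
    have e2 : U₂ᴴ * (U₂ * D * V₂ᴴ) = (U₂ᴴ * U₂) * D * V₂ᴴ := by simp only [Matrix.mul_assoc]
    rw [e1, e2, h21, h22]
    simp
  have hUeq : U = M * V * (svDiag m M)⁻¹ := by
    have e : M * V = U * svDiag m M := by
      calc M * V = U * svDiag m M * Vᴴ * V := by rw [← hMUV]
        _ = _ := by rw [Matrix.mul_assoc, hV, Matrix.mul_one]
    rw [e, Matrix.mul_nonsing_inv_cancel_right _ _ (isUnit_det_svDiag hs)]
  have hsmall : norm2 ((U₂ᴴ * U) *ᵥ x) ≤ 1 / 2 * norm2 x := by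
    set y := (svDiag m M)⁻¹ *ᵥ x with hy
    have hyx : norm2 y ≤ s⁻¹ * norm2 x := by
      rw [hy, svDiag_inv hs]
      exact norm2_diagonal_mulVec_le (by positivity) (norm_sv_inv_le hs le_rfl) x
    have e : (U₂ᴴ * U) *ᵥ x = D *ᵥ (V₂ᴴ *ᵥ (V *ᵥ y)) - U₂ᴴ *ᵥ ((M' - M) *ᵥ (V *ᵥ y)) := by
      conv_lhs => rw [hUeq]
      rw [hy]
      simp only [Matrix.mulVec_mulVec]
      rw [← Matrix.sub_mulVec]
      congr 1
      rw [← Matrix.mul_assoc D, ← hUM']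
      simp only [Matrix.mul_assoc, Matrix.sub_mul, Matrix.mul_sub, sub_sub_cancel]
    have hsv : ∀ j : Fin (Fintype.card ι - m), ‖(sv M' (m + j) : ℂ)‖ ≤ s / 4 := fun j => by
      rw [Complex.norm_real, Real.norm_of_nonneg (sv_nonneg _ _)]
      refine (sv_le_add M' M (m + j)).trans ?_
      rw [sv_eq_zero_of_rank_le (by omega), zero_add]
      exact hM
    have hVy : norm2 (V *ᵥ y) = norm2 y := norm2_mulVec_of_isometry hV y
    have t1 : norm2 (D *ᵥ (V₂ᴴ *ᵥ (V *ᵥ y))) ≤ s / 4 * norm2 y := by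
      refine (norm2_diagonal_mulVec_le (by positivity) hsv _).trans ?_
      gcongr
      exact (norm2_conjTranspose_mulVec_le k22 _).trans_eq hVy
    have t2 : norm2 (U₂ᴴ *ᵥ ((M' - M) *ᵥ (V *ᵥ y))) ≤ s / 4 * norm2 y := by
      refine (norm2_conjTranspose_mulVec_le h22 _).trans ((norm2_mulVec_le _ _).trans ?_)
      rw [hVy]
      gcongr
      exact norm2_nonneg y
    rw [e]
    refine (norm2_sub_le _ _).trans ?_
    calc _ ≤ s / 2 * norm2 y := by linarith
      _ ≤ s / 2 * (s⁻¹ * norm2 x) := by gcongr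
      _ = 1 / 2 * norm2 x := by field_simp
  linarith

end DominantSVD

/-! ### The perturbed pencil -/

section Pencil

variable {ι κ : Type*} [Fintype ι] [Fintype κ] [DecidableEq κ]

/-- An exact formula for the perturbed pencil in the compressed exact eigenbasis. -/
lemma pencil_similar {W Z S : Matrix κ κ ℂ} {L : Matrix κ ι ℂ} {U U' V' : Matrix ι κ ℂ}
    {T T' P P' : Matrix ι ι ℂ} (hT : T = U * W * L) (hP : P = U * W * Z * L)
    (hS : U'ᴴ * T' * V' = S) (hSu : IsUnit S.det) (hWu : IsUnit (U'ᴴ * U * W).det) :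
    (U'ᴴ * U * W)⁻¹ * (U'ᴴ * P' * V' * S⁻¹) * (U'ᴴ * U * W) =
      Z + ((U'ᴴ * U * W)⁻¹ * (U'ᴴ * (P' - P) * V') -
        Z * ((U'ᴴ * U * W)⁻¹ * (U'ᴴ * (T' - T) * V'))) * (S⁻¹ * (U'ᴴ * U * W)) := by
  have e1 : U'ᴴ * P * V' = U'ᴴ * U * W * Z * (L * V') := by rw [hP]; simp only [Matrix.mul_assoc]
  have e2 : U'ᴴ * T * V' = U'ᴴ * U * W * (L * V') := by rw [hT]; simp only [Matrix.mul_assoc]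
  set X := U'ᴴ * U * W
  rw [Matrix.mul_sub U'ᴴ P', Matrix.mul_sub U'ᴴ T', Matrix.sub_mul _ _ V', Matrix.sub_mul _ _ V',
    e1, e2, hS, Matrix.mul_sub X⁻¹ (U'ᴴ * P' * V'), Matrix.mul_sub X⁻¹ S]
  have e3 : X⁻¹ * (X * Z * (L * V')) = Z * (L * V') := by
    rw [Matrix.mul_assoc X, Matrix.nonsing_inv_mul_cancel_left _ _ hWu]
  have e4 : X⁻¹ * (X * (L * V')) = L * V' := Matrix.nonsing_inv_mul_cancel_left _ _ hWu
  rw [e3, e4, Matrix.mul_sub Z]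
  have e5 : Z * (X⁻¹ * S) * (S⁻¹ * X) = Z := by
    rw [Matrix.mul_assoc, Matrix.mul_assoc, Matrix.mul_nonsing_inv_cancel_left _ _ hSu,
      Matrix.nonsing_inv_mul _ hWu, Matrix.mul_one]
  simp only [Matrix.sub_mul]
  rw [e5]
  simp only [← Matrix.mul_assoc]
  abel

lemma pencil_error_le {W S : Matrix κ κ ℂ} {U U' V' : Matrix ι κ ℂ} {E F : Matrix ι ι ℂ}
    {z : κ → ℂ} {s : ℝ} (hU : Uᴴ * U = 1) (hU' : U'ᴴ * U' = 1) (hV' : V'ᴴ * V' = 1)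
    (hz : ∀ j, ‖z j‖ ≤ 1) (hs : 0 ≤ s) (hS : ∀ P : Matrix κ κ ℂ, ‖S⁻¹ * P‖ ≤ s * ‖P‖) :
    ‖((U'ᴴ * U * W)⁻¹ * (U'ᴴ * E * V') -
        Matrix.diagonal z * ((U'ᴴ * U * W)⁻¹ * (U'ᴴ * F * V'))) * (S⁻¹ * (U'ᴴ * U * W))‖ ≤
      ‖(U'ᴴ * U * W)⁻¹‖ * (‖E‖ + ‖F‖) * (s * ‖W‖) := by
  set X := U'ᴴ * U * W with hX
  have h1 : ∀ G : Matrix ι ι ℂ, ‖X⁻¹ * (U'ᴴ * G * V')‖ ≤ ‖X⁻¹‖ * ‖G‖ := fun G =>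
    (Matrix.frobenius_norm_mul _ _).trans (mul_le_mul_of_nonneg_left
      ((frobenius_mul_isometry_le hV' _).trans (frobenius_conjTranspose_mul_le hU' _))
      (norm_nonneg _))
  have h2 : ‖S⁻¹ * X‖ ≤ s * ‖W‖ := by
    refine (hS X).trans (mul_le_mul_of_nonneg_left ?_ hs)
    rw [hX, Matrix.mul_assoc]
    exact (frobenius_conjTranspose_mul_le hU' _).trans_eq (frobenius_isometry_mul hU _)
  refine (Matrix.frobenius_norm_mul _ _).trans (mul_le_mul ?_ h2 (norm_nonneg _) (by positivity))
  refine (norm_sub_le _ _).trans ?_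
  have h3 := frobenius_diagonal_mul_le zero_le_one hz (X⁻¹ * (U'ᴴ * F * V'))
  linarith [h1 E, h1 F]

end Pencil

/-! ### Exact data -/

/-- The character `k ↦ exp(-2πi ⟨s, k⟩)` of `ℤ^d`. -/
noncomputable def character {d : ℕ} (s : Fin d → ℝ) (k : Fin d → ℤ) : ℂ :=
  Complex.exp (-2 * Real.pi * Complex.I * ∑ l, (s l : ℂ) * (k l : ℂ))

section Character

variable {d m n : ℕ}

lemma character_add (s : Fin d → ℝ) (k h : Fin d → ℤ) :
    character s (k + h) = character s k * character s h := by
  rw [character, character, character, ← Complex.exp_add, ← mul_add, ← Finset.sum_add_distrib]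
  congr 2
  refine Finset.sum_congr rfl fun l _ => ?_
  rw [Pi.add_apply]
  push_cast
  ring

lemma character_neg (s : Fin d → ℝ) (k : Fin d → ℤ) : character s (-k) = star (character s k) := by
  rw [character, character, ← starRingEnd_apply, ← Complex.exp_conj]
  congr 1
  simp only [map_mul, map_neg, map_sum, Complex.conj_ofReal, Complex.conj_I, map_ofNat, map_intCast,
    Pi.neg_apply, Int.cast_neg, mul_neg, Finset.sum_neg_distrib, neg_mul]

lemma character_single (t : Fin m → Fin d → ℝ) (j : Fin m) (l : Fin d) :
    character (t j) (Pi.single l 1) = nodes t j l := by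
  rw [character, nodes]
  congr 2
  rw [Finset.sum_eq_single l]
  · simp
  · intro i _ hi; simp [hi]
  · simp

lemma character_natCast (t : Fin m → Fin d → ℝ) (j : Fin m) (k : Grid d n) :
    character (t j) (fun i => ((k i : ℕ) : ℤ)) = nodeMatrix n (nodes t) j k := by
  rw [character, nodeMatrix, Matrix.of_apply, Finset.mul_sum, Complex.exp_sum]
  refine Finset.prod_congr rfl fun l _ => ?_
  rw [nodes, ← Complex.exp_nat_mul]
  congr 1
  push_cast
  ring

lemma norm_nodes (t : Fin m → Fin d → ℝ) (j : Fin m) (l : Fin d) : ‖nodes t j l‖ = 1 := by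
  rw [nodes, Complex.norm_exp]
  simp

lemma norm_nodeMatrix_nodes (t : Fin m → Fin d → ℝ) (j : Fin m) (k : Grid d n) :
    ‖nodeMatrix n (nodes t) j k‖ = 1 := by
  rw [nodeMatrix, Matrix.of_apply, norm_prod]
  exact Finset.prod_eq_one fun l _ => by rw [norm_pow, norm_nodes, one_pow]

lemma expSum_eq (t : Fin m → Fin d → ℝ) (c : Fin m → ℂ) (k : Fin d → ℤ) :
    expSum t c k = ∑ j, c j * character (t j) k := rfl

lemma expSum_comp_perm (t : Fin m → Fin d → ℝ) (c : Fin m → ℂ) (τ : Equiv.Perm (Fin m)) :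
    expSum (fun j => t (τ j)) (fun j => c (τ j)) = expSum t c := by
  ext k
  rw [expSum_eq, expSum_eq]
  exact Equiv.sum_comp τ fun j => c j * character (t j) k

lemma sampleVector_expSum (t : Fin m → Fin d → ℝ) (c : Fin m → ℂ) :
    sampleVector n (expSum t c) = (nodeMatrix n (nodes t))ᵀ *ᵥ c := by
  ext k
  rw [sampleVector, expSum_eq, Matrix.mulVec, dotProduct]
  refine Finset.sum_congr rfl fun j _ => ?_
  rw [character_natCast, Matrix.transpose_apply, mul_comm]

lemma character_sub (t : Fin m → Fin d → ℝ) (j : Fin m) (k h : Grid d n) :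
    character (t j) (fun i => ((k i : ℕ) : ℤ) - ((h i : ℕ) : ℤ)) =
      nodeMatrix n (nodes t) j k * star (nodeMatrix n (nodes t) j h) := by
  rw [← character_natCast, ← character_natCast, ← character_neg, ← character_add]
  rfl

lemma sampleMatrix_expSum (t : Fin m → Fin d → ℝ) (c : Fin m → ℂ) :
    sampleMatrix n (expSum t c) =
      (nodeMatrix n (nodes t))ᵀ * Matrix.diagonal c * (nodeMatrix n (nodes t))ᵀᴴ := by
  ext k h
  rw [sampleMatrix, Matrix.of_apply, expSum_eq, Matrix.mul_apply]
  refine Finset.sum_congr rfl fun j _ => ?_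
  rw [character_sub, Matrix.mul_diagonal, Matrix.conjTranspose_apply, Matrix.transpose_apply,
    Matrix.transpose_apply]
  ring

lemma shiftedMatrix_expSum (t : Fin m → Fin d → ℝ) (c : Fin m → ℂ) (l : Fin d) :
    shiftedMatrix n (expSum t c) l =
      (nodeMatrix n (nodes t))ᵀ * Matrix.diagonal c * Matrix.diagonal (fun j => nodes t j l) *
        (nodeMatrix n (nodes t))ᵀᴴ := by
  ext k h
  rw [shiftedMatrix, Matrix.of_apply, expSum_eq, Matrix.mul_apply]
  refine Finset.sum_congr rfl fun j _ => ?_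
  rw [character_add, character_sub, character_single, Matrix.mul_diagonal, Matrix.mul_diagonal,
    Matrix.conjTranspose_apply, Matrix.transpose_apply, Matrix.transpose_apply]
  ring

lemma rank_nodeMatrix {t : Fin m → Fin d → ℝ} {c : Fin m → ℂ}
    (hr : (sampleMatrix n (expSum t c)).rank = m) : (nodeMatrix n (nodes t)).rank = m := by
  refine le_antisymm (by simpa using Matrix.rank_le_card_height (nodeMatrix n (nodes t))) ?_
  have h1 : (sampleMatrix n (expSum t c)).rank ≤ (nodeMatrix n (nodes t))ᵀ.rank := by
    rw [sampleMatrix_expSum, Matrix.mul_assoc]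
    exact Matrix.rank_mul_le_left _ _
  rwa [hr, Matrix.rank_transpose] at h1

end Character

/-- Eigenvectors for distinct eigenvalues form an invertible matrix. -/
lemma IsPencilRun.isUnit_det {d m n : ℕ} {g : (Fin d → ℤ) → ℂ} {μ : Fin d → ℂ}
    {U V : Matrix (Grid d n) (Fin m) ℂ} {W : Matrix (Fin m) (Fin m) ℂ} {lam : Fin m → ℂ}
    (h : IsPencilRun n g μ U V W lam) : IsUnit W.det := by
  rw [← Matrix.isUnit_iff_isUnit_det, ← Matrix.linearIndependent_cols_iff_isUnit]
  refine Module.End.eigenvectors_linearIndependent'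
    (Matrix.toLin' (∑ l, μ l • pencilMatrix n g U V l)) lam h.distinct _ fun j => ?_
  rw [Module.End.hasEigenvector_iff, Module.End.mem_eigenspace_iff]
  constructor
  · rw [Matrix.toLin'_apply, ← col_mul, h.eigen]
    ext i
    rw [Matrix.col_apply, Matrix.mul_diagonal, Pi.smul_apply, Matrix.col_apply, smul_eq_mul,
      mul_comm]
  · intro h0
    have := h.unit_col j
    rw [h0, norm2_eq_zero.mpr rfl] at this
    exact zero_ne_one this

lemma IsPencilRun.norm_eq {d m n : ℕ} {g : (Fin d → ℤ) → ℂ} {μ : Fin d → ℂ}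
    {U V : Matrix (Grid d n) (Fin m) ℂ} {W : Matrix (Fin m) (Fin m) ℂ} {lam : Fin m → ℂ}
    (h : IsPencilRun n g μ U V W lam) : ‖W‖ = √(m : ℝ) := by
  rw [← Real.sqrt_sq (norm_nonneg W), frobenius_sq_cols]
  simp [h.unit_col]

section Exact

variable {d m n : ℕ} {t : Fin m → Fin d → ℝ} {c : Fin m → ℂ} {μ : Fin d → ℂ}
  {U V : Matrix (Grid d n) (Fin m) ℂ} {W : Matrix (Fin m) (Fin m) ℂ} {lam : Fin m → ℂ}

open scoped ComplexOrder in
/-- In the range of the exact `T = B D Bᴴ`, both `B = U Uᴴ B` and `Bᴴ = Bᴴ V Vᴴ`. -/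
lemma projection_mul_nodeMatrix (hr : (sampleMatrix n (expSum t c)).rank = m)
    (hc : ∀ j, c j ≠ 0) (h : IsDominantSVD (sampleMatrix n (expSum t c)) U V) :
    U * (Uᴴ * (nodeMatrix n (nodes t))ᵀ) = (nodeMatrix n (nodes t))ᵀ ∧
      (nodeMatrix n (nodes t))ᵀᴴ * V * Vᴴ = (nodeMatrix n (nodes t))ᵀᴴ := by
  have hU := h.left_isometry
  have hV := h.right_isometry
  have hT := h.eq_reduced hr
  have hB : ((nodeMatrix n (nodes t))ᵀ).rank = m := by
    rw [Matrix.rank_transpose]; exact rank_nodeMatrix hr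
  rw [sampleMatrix_expSum] at hT
  set B := (nodeMatrix n (nodes t))ᵀ
  set D := Matrix.diagonal c
  set S := svDiag m (B * D * Bᴴ)
  have hG : IsUnit (Bᴴ * B).det := by
    rw [← Matrix.isUnit_iff_isUnit_det]
    refine isUnit_of_rank_eq_card ?_
    rw [Matrix.rank_conjTranspose_mul_self, hB, Fintype.card_fin]
  have hD : IsUnit D.det := by
    rw [Matrix.det_diagonal, isUnit_iff_ne_zero, Finset.prod_ne_zero_iff]
    exact fun j _ => hc j
  have hBT : B = B * D * Bᴴ * (B * ((Bᴴ * B)⁻¹ * D⁻¹)) := by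
    calc B = B * D * D⁻¹ := by rw [Matrix.mul_nonsing_inv_cancel_right _ _ hD]
      _ = B * D * ((Bᴴ * B) * (Bᴴ * B)⁻¹) * D⁻¹ := by
        rw [Matrix.mul_nonsing_inv _ hG, Matrix.mul_one]
      _ = _ := by simp only [Matrix.mul_assoc]
  have hBT' : Bᴴ = (D⁻¹ * ((Bᴴ * B)⁻¹ * Bᴴ)) * (B * D * Bᴴ) := by
    calc Bᴴ = D⁻¹ * (D * Bᴴ) := by rw [Matrix.nonsing_inv_mul_cancel_left _ _ hD]
      _ = D⁻¹ * ((Bᴴ * B)⁻¹ * (Bᴴ * B)) * (D * Bᴴ) := by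
        rw [Matrix.nonsing_inv_mul _ hG, Matrix.mul_one]
      _ = _ := by simp only [Matrix.mul_assoc]
  constructor
  · rw [hBT, hT]
    calc U * (Uᴴ * (U * S * Vᴴ * (B * ((Bᴴ * B)⁻¹ * D⁻¹))))
        = U * (Uᴴ * U) * (S * Vᴴ * (B * ((Bᴴ * B)⁻¹ * D⁻¹))) := by simp only [Matrix.mul_assoc]
      _ = _ := by rw [hU, Matrix.mul_one]; simp only [Matrix.mul_assoc]
  · rw [hBT', hT]
    calc D⁻¹ * ((Bᴴ * B)⁻¹ * Bᴴ) * (U * S * Vᴴ) * V * Vᴴ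
        = D⁻¹ * ((Bᴴ * B)⁻¹ * Bᴴ) * (U * S) * (Vᴴ * V) * Vᴴ := by simp only [Matrix.mul_assoc]
      _ = _ := by rw [hV, Matrix.mul_one]; simp only [Matrix.mul_assoc]

lemma sv_pos_of_rank_eq {ι : Type*} [Fintype ι] [DecidableEq ι] {M : Matrix ι ι ℂ} (hm : 0 < m)
    (hr : M.rank = m) : 0 < sv M (m - 1) := by
  rw [sv_pos_iff, hr]; omega

/-- The exact pencil matrices are simultaneously diagonalizable: with `X = Uᴴ B D`, one has
`S_l = X Z_l X⁻¹`, and distinct eigenvalues of `C_μ` leave only a permutation and a scaling of the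
columns of `X` for `W`. -/
lemma IsPencilRun.exists_perm (hr : (sampleMatrix n (expSum t c)).rank = m)
    (h : IsPencilRun n (expSum t c) μ U V W lam) :
    ∃ τ : Equiv.Perm (Fin m), ∀ l, W⁻¹ * pencilMatrix n (expSum t c) U V l * W =
      Matrix.diagonal fun j => nodes t (τ j) l := by
  rcases Nat.eq_zero_or_pos m with rfl | hm
  · exact ⟨1, fun l => Subsingleton.elim _ _⟩
  have hs := sv_pos_of_rank_eq hm hr
  have hWu := h.isUnit_det
  set X := Uᴴ * (nodeMatrix n (nodes t))ᵀ * Matrix.diagonal c with hX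
  set Y := (nodeMatrix n (nodes t))ᵀᴴ * V with hY
  set S := svDiag m (sampleMatrix n (expSum t c)) with hS
  have hSu : IsUnit S.det := isUnit_det_svDiag hs
  have hXY : S = X * Y := by
    rw [hS, ← h.svd.conjTranspose_mul_mul, hX, hY, sampleMatrix_expSum]
    simp only [Matrix.mul_assoc]
  have hXu : IsUnit X.det := by
    rw [hXY, Matrix.det_mul] at hSu
    exact isUnit_of_mul_isUnit_left hSu
  have hYu : IsUnit Y.det := by
    rw [hXY, Matrix.det_mul] at hSu
    exact isUnit_of_mul_isUnit_right hSu
  have hP : ∀ l, pencilMatrix n (expSum t c) U V l =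
      X * Matrix.diagonal (fun j => nodes t j l) * X⁻¹ := fun l => by
    rw [pencilMatrix, ← hS, hXY, Matrix.mul_inv_rev, shiftedMatrix_expSum]
    calc _ = X * Matrix.diagonal (fun j => nodes t j l) * (Y * (Y⁻¹ * X⁻¹)) := by
          rw [hX, hY]; simp only [Matrix.mul_assoc]
      _ = _ := by rw [Matrix.mul_nonsing_inv_cancel_left _ _ hYu]
  set G := X⁻¹ * W with hG
  have hGu : IsUnit G.det := by
    rw [hG, Matrix.det_mul]
    exact (Matrix.isUnit_nonsing_inv_det _ hXu).mul hWu
  have hXG : X * G = W := Matrix.mul_nonsing_inv_cancel_left _ _ hXu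
  set lx : Fin m → ℂ := fun j => ∑ l, μ l * nodes t j l with hlx
  have hC : ∑ l, μ l • pencilMatrix n (expSum t c) U V l = X * Matrix.diagonal lx * X⁻¹ := by
    have e : Matrix.diagonal lx = ∑ l, μ l • Matrix.diagonal (fun j => nodes t j l) := by
      ext i j
      simp only [hlx, Matrix.sum_apply, Matrix.smul_apply, Matrix.diagonal_apply, smul_eq_mul]
      split_ifs <;> simp
    rw [e, Matrix.mul_sum, Matrix.sum_mul]
    refine Finset.sum_congr rfl fun l _ => ?_
    rw [hP, Matrix.mul_smul, Matrix.smul_mul]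
  have hcomm : Matrix.diagonal lx * G = G * Matrix.diagonal lam := by
    have h1 := h.eigen
    rw [hC, ← hXG] at h1
    have h2 : X * (Matrix.diagonal lx * G) = X * (G * Matrix.diagonal lam) := by
      rw [← Matrix.mul_assoc X G, ← h1]
      calc X * (Matrix.diagonal lx * G) = X * Matrix.diagonal lx * (X⁻¹ * (X * G)) := by
            rw [Matrix.nonsing_inv_mul_cancel_left _ _ hXu, Matrix.mul_assoc X]
        _ = _ := by simp only [Matrix.mul_assoc]
    calc _ = X⁻¹ * (X * (Matrix.diagonal lx * G)) := by
          rw [Matrix.nonsing_inv_mul_cancel_left _ _ hXu]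
      _ = _ := by rw [h2, Matrix.nonsing_inv_mul_cancel_left _ _ hXu]
  have hent : ∀ p i, G p i ≠ 0 → lx p = lam i := fun p i hp => by
    have h1 := congrFun (congrFun hcomm p) i
    rw [Matrix.diagonal_mul, Matrix.mul_diagonal, mul_comm] at h1
    exact mul_left_cancel₀ hp h1
  have hcol : ∀ i, ∃ p, G p i ≠ 0 := fun i => by
    by_contra! h0
    exact hGu.ne_zero (Matrix.det_eq_zero_of_column_eq_zero i h0)
  choose τ hτ using hcol
  have hτinj : Function.Injective τ := fun i j hij => h.distinct (by
    rw [← hent _ _ (hτ i), ← hent _ _ (hτ j), hij])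
  have hbij : Function.Bijective τ := Finite.injective_iff_bijective.mp hτinj
  have hzero : ∀ p i, G p i ≠ 0 → p = τ i := fun p i hp => by
    obtain ⟨j, rfl⟩ := hbij.2 p
    congr 1
    exact h.distinct (by rw [← hent _ _ (hτ j), ← hent _ _ hp])
  refine ⟨Equiv.ofBijective τ hbij, fun l => ?_⟩
  have hdiag : Matrix.diagonal (fun j => nodes t j l) * G =
      G * Matrix.diagonal (fun j => nodes t (τ j) l) := by
    ext p i
    rw [Matrix.diagonal_mul, Matrix.mul_diagonal, mul_comm]
    by_cases hp : G p i = 0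
    · rw [hp, zero_mul, zero_mul]
    · rw [hzero p i hp]
  have hSW : pencilMatrix n (expSum t c) U V l * W =
      W * Matrix.diagonal (fun j => nodes t (τ j) l) := by
    rw [hP, ← hXG, Matrix.mul_assoc (X * _), Matrix.nonsing_inv_mul_cancel_left _ _ hXu,
      Matrix.mul_assoc X, hdiag, Matrix.mul_assoc X]
  rw [Matrix.mul_assoc, hSW, Matrix.nonsing_inv_mul_cancel_left _ _ hWu]
  rfl

/-- The exact data in factored form. -/
lemma exists_factorization (hm : 0 < m) (hr : (sampleMatrix n (expSum t c)).rank = m)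
    (hc : ∀ j, c j ≠ 0) (h : IsPencilRun n (expSum t c) μ U V W lam)
    (hz : ∀ l, W⁻¹ * pencilMatrix n (expSum t c) U V l * W =
      Matrix.diagonal fun j => nodes t j l) :
    ∃ L : Matrix (Fin m) (Grid d n) ℂ, sampleMatrix n (expSum t c) = U * W * L ∧
      ∀ l, shiftedMatrix n (expSum t c) l =
        U * W * Matrix.diagonal (fun j => nodes t j l) * L := by
  have hs := sv_pos_of_rank_eq hm hr
  have hWu := h.isUnit_det
  have hSu := isUnit_det_svDiag hs
  obtain ⟨hB1, hB2⟩ := projection_mul_nodeMatrix hr hc h.svd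
  refine ⟨W⁻¹ * (svDiag m (sampleMatrix n (expSum t c)) * Vᴴ), ?_, fun l => ?_⟩
  · conv_lhs => rw [h.svd.eq_reduced hr]
    rw [Matrix.mul_assoc U W, Matrix.mul_nonsing_inv_cancel_left _ _ hWu, Matrix.mul_assoc]
  · have h1 : shiftedMatrix n (expSum t c) l =
        U * (Uᴴ * shiftedMatrix n (expSum t c) l * V) * Vᴴ := by
      rw [shiftedMatrix_expSum]
      set B := (nodeMatrix n (nodes t))ᵀ
      set D := Matrix.diagonal c
      set Z := Matrix.diagonal fun j => nodes t j l
      calc B * D * Z * Bᴴ = U * (Uᴴ * B) * D * Z * (Bᴴ * V * Vᴴ) := by rw [hB1, hB2]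
        _ = _ := by simp only [Matrix.mul_assoc]
    set S := svDiag m (sampleMatrix n (expSum t c)) with hS
    have h2 : Uᴴ * shiftedMatrix n (expSum t c) l * V =
        pencilMatrix n (expSum t c) U V l * S := by
      rw [pencilMatrix, ← hS, Matrix.nonsing_inv_mul_cancel_right _ _ hSu]
    have h3 : pencilMatrix n (expSum t c) U V l =
        W * Matrix.diagonal (fun j => nodes t j l) * W⁻¹ := by
      rw [← hz, Matrix.mul_assoc W⁻¹, Matrix.mul_nonsing_inv_cancel_left _ _ hWu,
        Matrix.mul_nonsing_inv_cancel_right _ _ hWu]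
    rw [h1, h2, h3]
    simp only [Matrix.mul_assoc]

/-- The eigenvalues of the exact `C_μ` in terms of the nodes. -/
lemma IsPencilRun.eigenvalue_eq (h : IsPencilRun n (expSum t c) μ U V W lam)
    (hz : ∀ l, W⁻¹ * pencilMatrix n (expSum t c) U V l * W =
      Matrix.diagonal fun j => nodes t j l) (j : Fin m) : lam j = ∑ l, μ l * nodes t j l := by
  have h1 : W⁻¹ * (∑ l, μ l • pencilMatrix n (expSum t c) U V l) * W = Matrix.diagonal lam := by
    rw [Matrix.mul_assoc, h.eigen, Matrix.nonsing_inv_mul_cancel_left _ _ h.isUnit_det]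
  rw [Matrix.mul_sum, Matrix.sum_mul] at h1
  simp only [Matrix.mul_smul, Matrix.smul_mul, hz] at h1
  have h2 := congrFun (congrFun h1 j) j
  rw [Matrix.diagonal_apply_eq, Matrix.sum_apply] at h2
  simpa using h2.symm

end Exact

/-! ### Perturbation of the extracted nodes -/

section Noise

variable {d n : ℕ} {f f' : (Fin d → ℤ) → ℂ} {ε : ℝ}

lemma norm_sampleMatrix_sub_le (hε : 0 ≤ ε) (hf : ∀ k, ‖f' k - f k‖ ≤ ε * ‖f k‖) :
    ‖sampleMatrix n f' - sampleMatrix n f‖ ≤ ε * ‖sampleMatrix n f‖ :=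
  frobenius_le_of_entry_le hε fun _ _ => hf _

lemma norm_shiftedMatrix_sub_le (hε : 0 ≤ ε) (hf : ∀ k, ‖f' k - f k‖ ≤ ε * ‖f k‖) (l : Fin d) :
    ‖shiftedMatrix n f' l - shiftedMatrix n f l‖ ≤ ε * ‖shiftedMatrix n f l‖ :=
  frobenius_le_of_entry_le hε fun _ _ => hf _

lemma norm2_sampleVector_sub_le (hε : 0 ≤ ε) (hf : ∀ k, ‖f' k - f k‖ ≤ ε * ‖f k‖) :
    norm2 (sampleVector n f' - sampleVector n f) ≤ ε * norm2 (sampleVector n f) := by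
  refine norm2_le_of_sq_le (mul_nonneg hε (norm2_nonneg _)) ?_
  rw [mul_pow, norm2_sq, Finset.mul_sum]
  refine Finset.sum_le_sum fun k _ => ?_
  rw [← mul_pow]
  exact pow_le_pow_left₀ (norm_nonneg _) (hf _) 2

end Noise

/-- The bound for the Frobenius norms of the errors `H_l` of the pencil matrices in the compressed
exact eigenbasis: `M` bounds the `‖T_l‖`, `r = ‖T‖`, `w = σ_min(W)` and `s` is the `m`-th singular
value of the noisy matrix. -/
noncomputable def pencilError (m : ℕ) (ε M r w s : ℝ) : ℝ := 2 * ε * m * (M + r) / (w * s)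

section Nodes

variable {d m n : ℕ} {t : Fin m → Fin d → ℝ} {c : Fin m → ℂ} {μ : Fin d → ℂ}
  {U V : Matrix (Grid d n) (Fin m) ℂ} {W : Matrix (Fin m) (Fin m) ℂ} {lam : Fin m → ℂ}
  {f' : (Fin d → ℤ) → ℂ} {U' V' : Matrix (Grid d n) (Fin m) ℂ} {W' : Matrix (Fin m) (Fin m) ℂ}
  {lam' : Fin m → ℂ}

/-- In the exact eigenbasis, compressed to the noisy singular vectors, the noisy pencil matrices are
`Z_l` up to a small error. -/
lemma IsPencilRun.exists_similar (hm : 0 < m) (hr : (sampleMatrix n (expSum t c)).rank = m)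
    (hc : ∀ j, c j ≠ 0) (h : IsPencilRun n (expSum t c) μ U V W lam)
    (hz : ∀ l, W⁻¹ * pencilMatrix n (expSum t c) U V l * W =
      Matrix.diagonal fun j => nodes t j l)
    {ε : ℝ} (hε : 0 ≤ ε) (hf : ∀ k, ‖f' k - expSum t c k‖ ≤ ε * ‖expSum t c k‖)
    (h' : IsDominantSVD (sampleMatrix n f') U' V')
    (hεT : ε * ‖sampleMatrix n (expSum t c)‖ ≤ sv (sampleMatrix n (expSum t c)) (m - 1) / 4)
    {M : ℝ} (hM : ∀ l, ‖shiftedMatrix n (expSum t c) l‖ ≤ M) :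
    ∃ X : Matrix (Fin m) (Fin m) ℂ, IsUnit X.det ∧
      ∃ H : Fin d → Matrix (Fin m) (Fin m) ℂ,
        (∀ l, X⁻¹ * pencilMatrix n f' U' V' l * X =
          Matrix.diagonal (fun j => nodes t j l) + H l) ∧
        ∀ l, ‖H l‖ ≤ pencilError m ε M ‖sampleMatrix n (expSum t c)‖ (svMin W)
          (sv (sampleMatrix n f') (m - 1)) := by
  have : Nonempty (Fin m) := ⟨⟨0, hm⟩⟩
  have hs := sv_pos_of_rank_eq hm hr
  have hWu := h.isUnit_det
  have hw : 0 < svMin W := svMin_pos_of_isUnit ((Matrix.isUnit_iff_isUnit_det W).mpr hWu)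
  have hΔT := (norm_sampleMatrix_sub_le (n := n) hε hf)
  have hΔT4 := hΔT.trans hεT
  have hs' : 0 < sv (sampleMatrix n f') (m - 1) := by
    have := sv_le_add (sampleMatrix n (expSum t c)) (sampleMatrix n f') (m - 1)
    rw [norm_sub_rev] at this
    linarith
  obtain ⟨L, hTL, hPL⟩ := exists_factorization hm hr hc h hz
  have hS := h'.conjTranspose_mul_mul
  have hSu := isUnit_det_svDiag hs'
  set S := svDiag m (sampleMatrix n f') with hSdef
  have hlow : ∀ x, svMin W / 2 * norm2 x ≤ norm2 ((U'ᴴ * U * W) *ᵥ x) := fun x => by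
    rw [← Matrix.mulVec_mulVec]
    have h1 := h.svd.half_norm2_le hr h' hΔT4 (W *ᵥ x)
    have h2 := svMin_mul_norm2_le W x
    linarith
  have hXu : IsUnit (U'ᴴ * U * W).det :=
    (Matrix.isUnit_iff_isUnit_det _).mp (isUnit_of_norm2_lower_bound (by positivity) hlow)
  have hXinv := frobenius_inv_le (by positivity) hlow
  rw [Fintype.card_fin] at hXinv
  have hsim := fun l => pencil_similar hTL (hPL l) hS hSu hXu (P' := shiftedMatrix n f' l)
  have herr := fun l => pencil_error_le (W := W) (S := S) (U := U) (U' := U') (V' := V')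
    (E := shiftedMatrix n f' l - shiftedMatrix n (expSum t c) l)
    (F := sampleMatrix n f' - sampleMatrix n (expSum t c)) (z := fun j => nodes t j l)
    h.svd.left_isometry h'.left_isometry h'.right_isometry
    (fun j => (norm_nodes t j l).le) (inv_nonneg.mpr hs'.le)
    (fun P => frobenius_svDiag_inv_mul_le hs' P)
  refine ⟨U'ᴴ * U * W, hXu, _, hsim, fun l => ?_⟩
  refine (herr l).trans ?_
  have h1 := (norm_shiftedMatrix_sub_le (n := n) hε hf l).trans
    (mul_le_mul_of_nonneg_left (hM l) hε)
  rw [h.norm_eq, pencilError]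
  calc _ ≤ √(m : ℝ) / (svMin W / 2) *
        (ε * M + ε * ‖sampleMatrix n (expSum t c)‖) *
        ((sv (sampleMatrix n f') (m - 1))⁻¹ * √(m : ℝ)) := by gcongr
    _ = 2 * ε * (√(m : ℝ) * √(m : ℝ)) * (M + ‖sampleMatrix n (expSum t c)‖) /
        (svMin W * sv (sampleMatrix n f') (m - 1)) := by field_simp
    _ = _ := by rw [Real.mul_self_sqrt (Nat.cast_nonneg m)]

/-- If the pencil matrices `S_l` are similar to `Z_l + H_l` with small `H_l`, then every eigenvalue
of the noisy `C_μ` is near an entry of `∑ l, μ l • Z_l`, and the extracted node is near the node at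
that index. -/
lemma IsPencilRun.exists_node_near {z : Fin m → Fin d → ℂ} (hz1 : ∀ j l, ‖z j l‖ ≤ 1)
    (hμ : norm2 μ = 1) (h' : IsPencilRun n f' μ U' V' W' lam')
    (hlam : ∀ j, lam j = ∑ l, μ l * z j l)
    {X : Matrix (Fin m) (Fin m) ℂ} (hXu : IsUnit X.det) {H : Fin d → Matrix (Fin m) (Fin m) ℂ}
    (hsim : ∀ l, X⁻¹ * pencilMatrix n f' U' V' l * X =
      Matrix.diagonal (fun j => z j l) + H l)
    {g h₀ : ℝ} (h₀0 : 0 ≤ h₀) (hH : ∀ l, ‖H l‖ ≤ h₀) (hg : 0 < g)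
    (hsep : ∀ i j, i ≠ j → g ≤ ‖lam i - lam j‖) (hh₀g : √(d : ℝ) * h₀ ≤ g / 8) (i : Fin m) :
    ∃ p, ‖lam p - lam' i‖ ≤ √(d : ℝ) * h₀ ∧ ∀ l,
      ‖extractedNodes n f' U' V' W' i l - z p l‖ ≤ 16 * d * h₀ ^ 2 / g ^ 2 + 2 * h₀ := by
  have hWu' := h'.isUnit_det
  set Hμ := ∑ l, μ l • H l with hHμ
  have hHμle : ‖Hμ‖ ≤ √(d : ℝ) * h₀ := by
    calc ‖Hμ‖ ≤ ∑ l, ‖μ l • H l‖ := norm_sum_le _ _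
      _ ≤ ∑ l, ‖μ l‖ * h₀ := Finset.sum_le_sum fun l _ => by
        rw [norm_smul]; exact mul_le_mul_of_nonneg_left (hH l) (norm_nonneg _)
      _ = (∑ l, ‖μ l‖) * h₀ := by rw [Finset.sum_mul]
      _ ≤ √(d : ℝ) * h₀ := by
        refine mul_le_mul_of_nonneg_right ?_ h₀0
        have := sum_norm_le_sqrt_card_mul μ
        rwa [hμ, mul_one, Fintype.card_fin] at this
  have hsimμ : X⁻¹ * (∑ l, μ l • pencilMatrix n f' U' V' l) * X =
      Matrix.diagonal lam + Hμ := by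
    have e : Matrix.diagonal lam = ∑ l, μ l • Matrix.diagonal (fun j => z j l) := by
      ext a b
      simp only [Matrix.sum_apply, Matrix.smul_apply, Matrix.diagonal_apply, smul_eq_mul]
      split_ifs with hab
      · exact hlam a
      · simp
    rw [e, hHμ, ← Finset.sum_add_distrib, Matrix.mul_sum, Matrix.sum_mul]
    refine Finset.sum_congr rfl fun l _ => ?_
    rw [Matrix.mul_smul, Matrix.smul_mul, hsim, smul_add]
  -- the noisy eigenvectors in the compressed exact eigenbasis
  set Y := X⁻¹ * W' with hY
  set Y' := W'⁻¹ * X with hY'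
  have hYeig : (Matrix.diagonal lam + Hμ) * Y = Y * Matrix.diagonal lam' := by
    rw [← hsimμ, hY, Matrix.mul_assoc (X⁻¹ * _), Matrix.mul_nonsing_inv_cancel_left _ _ hXu,
      Matrix.mul_assoc, h'.eigen, Matrix.mul_assoc]
  have hYeig' : Y' * (Matrix.diagonal lam + Hμ) = Matrix.diagonal lam' * Y' := by
    have e1 : W'⁻¹ * (∑ l, μ l • pencilMatrix n f' U' V' l) = Matrix.diagonal lam' * W'⁻¹ := by
      have e2 : ∑ l, μ l • pencilMatrix n f' U' V' l = W' * Matrix.diagonal lam' * W'⁻¹ := by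
        rw [← h'.eigen, Matrix.mul_nonsing_inv_cancel_right _ _ hWu']
      rw [e2, Matrix.mul_assoc W', Matrix.nonsing_inv_mul_cancel_left _ _ hWu']
    rw [← hsimμ, hY', Matrix.mul_assoc W'⁻¹ X, Matrix.mul_assoc X⁻¹,
      Matrix.mul_nonsing_inv_cancel_left _ _ hXu, ← Matrix.mul_assoc, e1, Matrix.mul_assoc]
  have hYY : Y' * Y = 1 := by
    rw [hY, hY', Matrix.mul_assoc, Matrix.mul_nonsing_inv_cancel_left _ _ hXu,
      Matrix.nonsing_inv_mul _ hWu']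
  have hcol : (Matrix.diagonal lam + Hμ) *ᵥ Y.col i = lam' i • Y.col i := by
    rw [← col_mul, hYeig]
    ext a
    rw [Matrix.col_apply, Matrix.mul_diagonal, Pi.smul_apply, Matrix.col_apply, smul_eq_mul,
      mul_comm]
  have hrow : Y' i ᵥ* (Matrix.diagonal lam + Hμ) = lam' i • Y' i := by
    rw [← Matrix.mul_apply_eq_vecMul, hYeig']
    ext a
    rw [Matrix.diagonal_mul, Pi.smul_apply, smul_eq_mul]
  have hdot : Y' i ⬝ᵥ Y.col i = 1 := by
    have := congrFun (congrFun hYY i) i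
    rwa [Matrix.one_apply_eq] at this
  obtain ⟨p, hp, hpz⟩ := exists_eigenpair_near hg hsep hHμle hh₀g hrow hcol hdot
  refine ⟨p, hp, fun l => ?_⟩
  have hext : extractedNodes n f' U' V' W' i l =
      Y' i ⬝ᵥ ((Matrix.diagonal (fun j => z j l) + H l) *ᵥ Y.col i) := by
    have e : W'⁻¹ * pencilMatrix n f' U' V' l * W' =
        Y' * ((Matrix.diagonal (fun j => z j l) + H l) * Y) := by
      rw [← hsim, hY, hY', Matrix.mul_assoc (X⁻¹ * _) X,
        Matrix.mul_nonsing_inv_cancel_left _ _ hXu, Matrix.mul_assoc W'⁻¹ X, Matrix.mul_assoc X⁻¹,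
        Matrix.mul_nonsing_inv_cancel_left _ _ hXu, Matrix.mul_assoc]
    rw [extractedNodes, e, ← col_mul]
    rfl
  rw [hext]
  refine (hpz (fun j => z j l) (H l) fun j => hz1 j l).trans ?_
  rw [mul_pow, Real.sq_sqrt (Nat.cast_nonneg d)]
  have := hH l
  have e : 16 * ((d : ℝ) * h₀ ^ 2) / g ^ 2 = 16 * d * h₀ ^ 2 / g ^ 2 := by ring
  rw [e]
  linarith

end Nodes

/-! ### Bounds for the factors of the amplification -/

section Factors

variable {d m n : ℕ} {t : Fin m → Fin d → ℝ} {c : Fin m → ℂ} {μ : Fin d → ℂ}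
  {U V : Matrix (Grid d n) (Fin m) ℂ} {W : Matrix (Fin m) (Fin m) ℂ} {lam : Fin m → ℂ}

lemma exists_separation {lam : Fin m → ℂ} (h : Function.Injective lam) :
    ∃ g : ℝ, 0 < g ∧ ∀ i j, i ≠ j → g ≤ ‖lam i - lam j‖ := by
  rcases isEmpty_or_nonempty {p : Fin m × Fin m // p.1 ≠ p.2} with he | he
  · exact ⟨1, one_pos, fun i j hij => (he.false ⟨(i, j), hij⟩).elim⟩
  · obtain ⟨p, hp⟩ := Finite.exists_min
      fun p : {p : Fin m × Fin m // p.1 ≠ p.2} => ‖lam p.1.1 - lam p.1.2‖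
    exact ⟨_, norm_pos_iff.mpr (sub_ne_zero.mpr fun e => p.2 (h e)),
      fun i j hij => hp ⟨(i, j), hij⟩⟩

lemma eigGap_le (lam lam' : Fin m → ℂ) {i j : Fin m} (h : j ≠ i) :
    eigGap lam lam' ≤ ‖lam j - lam' i‖ :=
  ciInf_le (f := fun p : {p : Fin m × Fin m // p.2 ≠ p.1} => ‖lam p.1.2 - lam' p.1.1‖)
    (Set.finite_range _).bddBelow ⟨(i, j), h⟩

lemma svGap_le {ι : Type*} [Fintype ι] [DecidableEq ι] (hm : 0 < m) (T T' : Matrix ι ι ℂ) :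
    svGap m T T' ≤ sv T (m - 1) :=
  (ciInf_le (Set.finite_range _).bddBelow (⟨m - 1, by omega⟩ : Fin m)).trans (min_le_right _ _)

lemma sv_le_frobenius {ι κ : Type*} [Fintype ι] [Fintype κ] [DecidableEq κ] (M : Matrix ι κ ℂ)
    (i : ℕ) : sv M i ≤ ‖M‖ := by
  have h := sv_le_add M 0 i
  have h0 : sv (0 : Matrix ι κ ℂ) i = 0 :=
    sv_eq_zero_of_rank_le (by rw [Matrix.rank_zero]; exact Nat.zero_le _)
  rwa [h0, zero_add, sub_zero] at h

lemma IsPencilRun.svMin_le_one {g : (Fin d → ℤ) → ℂ} (hm : 0 < m)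
    (h : IsPencilRun n g μ U V W lam) : svMin W ≤ 1 := by
  have h1 := svMin_mul_norm2_le W (Pi.single ⟨0, hm⟩ 1)
  rwa [norm2_single, norm_one, mul_one, Matrix.mulVec_single_one, h.unit_col] at h1

/-- The exact pencil matrices have eigenvalues of modulus one, so `‖T_l‖ ≥ σ_m`. -/
lemma IsPencilRun.sv_le_norm_shiftedMatrix (hm : 0 < m)
    (hr : (sampleMatrix n (expSum t c)).rank = m) (h : IsPencilRun n (expSum t c) μ U V W lam)
    (hz : ∀ l, W⁻¹ * pencilMatrix n (expSum t c) U V l * W =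
      Matrix.diagonal fun j => nodes t j l) (l : Fin d) :
    sv (sampleMatrix n (expSum t c)) (m - 1) ≤ ‖shiftedMatrix n (expSum t c) l‖ := by
  have hs := sv_pos_of_rank_eq hm hr
  have hW0 : 0 < ‖W‖ := by
    rw [h.norm_eq]; positivity
  have h1 : pencilMatrix n (expSum t c) U V l * W =
      W * Matrix.diagonal (fun j => nodes t j l) := by
    rw [← hz, Matrix.mul_assoc W⁻¹, Matrix.mul_nonsing_inv_cancel_left _ _ h.isUnit_det]
  have h2 : ‖W‖ ≤ 1 * ‖W * Matrix.diagonal (fun j => nodes t j l)‖ :=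
    frobenius_le_of_entry_le zero_le_one fun i j => by
      rw [Matrix.mul_diagonal, norm_mul, norm_nodes, mul_one, one_mul]
  rw [one_mul, ← h1, pencilMatrix, Matrix.mul_assoc] at h2
  have h3 : ‖W‖ ≤ ‖shiftedMatrix n (expSum t c) l‖ *
      ((sv (sampleMatrix n (expSum t c)) (m - 1))⁻¹ * ‖W‖) :=
    h2.trans ((Matrix.frobenius_norm_mul _ _).trans (mul_le_mul
      ((frobenius_mul_isometry_le h.svd.right_isometry _).trans
        (frobenius_conjTranspose_mul_le h.svd.left_isometry _))
      (frobenius_svDiag_inv_mul_le hs W) (norm_nonneg _) (norm_nonneg _)))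
  have h4 : 1 * ‖W‖ ≤ ‖shiftedMatrix n (expSum t c) l‖ *
      (sv (sampleMatrix n (expSum t c)) (m - 1))⁻¹ * ‖W‖ := by linarith
  have h5 := le_of_mul_le_mul_right h4 hW0
  rwa [← div_eq_mul_inv, one_le_div hs] at h5

lemma IsPencilRun.norm_eigenvalue_le (hμ : norm2 μ = 1)
    (h : IsPencilRun n (expSum t c) μ U V W lam)
    (hz : ∀ l, W⁻¹ * pencilMatrix n (expSum t c) U V l * W =
      Matrix.diagonal fun j => nodes t j l) (j : Fin m) : ‖lam j‖ ≤ √(d : ℝ) := by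
  rw [h.eigenvalue_eq hz]
  refine (norm_sum_le _ _).trans ?_
  simp only [norm_mul, norm_nodes, mul_one]
  have := sum_norm_le_sqrt_card_mul μ
  rwa [hμ, mul_one, Fintype.card_fin] at this

lemma mul_sqrt_eq_rpow {x : ℝ} (hx : 0 < x) : x * √x = x ^ (3 / 2 : ℝ) := by
  rw [Real.sqrt_eq_rpow]
  nth_rw 1 [← Real.rpow_one x]
  rw [← Real.rpow_add hx]
  norm_num

lemma mul_le_eigGap_mul_amplification {f f' : (Fin d → ℤ) → ℂ} {lam' : Fin m → ℂ}
    (hd : 0 < d) (hm : 0 < m) (hκ : 1 ≤ cond2 W) (hw : 0 < svMin W)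
    (hγ : 0 < eigGap lam lam') (hδ : 0 < svGap m (sampleMatrix n f) (sampleMatrix n f'))
    (hs : 0 < sv (sampleMatrix n f') (m - 1)) :
    d * √(d : ℝ) * m * (n * ‖sampleMatrix n f‖ * (⨆ l : Fin d, ‖shiftedMatrix n f l‖) /
      (svGap m (sampleMatrix n f) (sampleMatrix n f') * sv (sampleMatrix n f') (m - 1) *
        svMin W)) ≤ eigGap lam lam' * amplification n f f' W lam lam' := by
  have hM : 0 ≤ ⨆ l : Fin d, ‖shiftedMatrix n f l‖ := Real.iSup_nonneg fun _ => norm_nonneg _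
  have hd' : (0 : ℝ) < d := by exact_mod_cast hd
  have hm' : (1 : ℝ) ≤ m := by exact_mod_cast hm
  rw [amplification, ← mul_sqrt_eq_rpow hd', ← mul_sqrt_eq_rpow (by linarith : (0 : ℝ) < m)]
  set R := n * ‖sampleMatrix n f‖ * (⨆ l : Fin d, ‖shiftedMatrix n f l‖) /
      (svGap m (sampleMatrix n f) (sampleMatrix n f') * sv (sampleMatrix n f') (m - 1) *
        svMin W) with hR
  have hR0 : 0 ≤ R := by positivity
  have e : eigGap lam lam' * (d * √(d : ℝ) * (m * √(m : ℝ)) * n * √(((n : ℝ) + 1) ^ d) *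
      ‖sampleMatrix n f‖ * (⨆ l : Fin d, ‖shiftedMatrix n f l‖) * cond2 W /
        (eigGap lam lam' * svGap m (sampleMatrix n f) (sampleMatrix n f') *
          sv (sampleMatrix n f') (m - 1) * svMin W)) =
      d * √(d : ℝ) * m * R * (√(m : ℝ) * √(((n : ℝ) + 1) ^ d) * cond2 W) := by
    rw [hR]; field_simp
  rw [e]
  refine le_mul_of_one_le_right (by positivity) ?_
  have h1 : 1 ≤ √(m : ℝ) := Real.one_le_sqrt.mpr hm'
  have h2 : 1 ≤ √(((n : ℝ) + 1) ^ d) :=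
    Real.one_le_sqrt.mpr (one_le_pow₀ (by linarith [Nat.cast_nonneg (α := ℝ) n]))
  exact one_le_mul_of_one_le_of_one_le (one_le_mul_of_one_le_of_one_le h1 h2) hκ

lemma pencilError_nonneg {ε M r w s : ℝ} (hε : 0 ≤ ε) (hM : 0 ≤ M) (hr : 0 ≤ r) (hw : 0 ≤ w)
    (hs : 0 ≤ s) : 0 ≤ pencilError m ε M r w s := by
  rw [pencilError]; positivity

lemma pencilError_le_mul {ε M r w s s₁ : ℝ} (hε : 0 ≤ ε) (hM : 0 ≤ M) (hr : 0 ≤ r) (hw : 0 < w)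
    (hs : 0 < s) (h : s / 2 ≤ s₁) :
    pencilError m ε M r w s₁ ≤ 4 * m * (M + r) / (w * s) * ε := by
  rw [pencilError]
  calc 2 * ε * m * (M + r) / (w * s₁) ≤ 2 * ε * m * (M + r) / (w * (s / 2)) := by gcongr
    _ = _ := by field_simp; ring

/-- The error of the nodes is of first order in the error of the pencil. -/
lemma node_error_le {x g h : ℝ} (hx : 0 ≤ x) (hg : 0 < g) (hh : 0 ≤ h) (hxg : √x * h ≤ g / 8) :
    16 * x * h ^ 2 / g ^ 2 + 2 * h ≤ (2 + 2 * √x / g) * h := by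
  have e1 : 16 * x * h ^ 2 / g ^ 2 = 16 * √x * h / g ^ 2 * (√x * h) := by
    nth_rw 1 [← Real.mul_self_sqrt hx]
    ring
  have e2 : 2 * √x / g * h = 16 * √x * h / g ^ 2 * (g / 8) := by
    field_simp; ring
  have h1 : 16 * x * h ^ 2 / g ^ 2 ≤ 2 * √x / g * h := by
    rw [e1, e2]
    exact mul_le_mul_of_nonneg_left hxg (by positivity)
  linarith

/-- The quotient in the amplification is bounded from below: `δ ≤ r`, and the noisy singular value
`s` is at most `2 M`. -/
lemma half_le_quotient {x r M δ s w : ℝ} (hx : 1 ≤ x) (hδ : 0 < δ) (hs : 0 < s) (hw : 0 < w)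
    (hw1 : w ≤ 1) (hδr : δ ≤ r) (hM : s ≤ 2 * M) : 1 / 2 ≤ x * r * M / (δ * s * w) := by
  rw [le_div_iff₀ (by positivity)]
  have hM0 : 0 < M := by linarith
  have hr0 : 0 < r := by linarith
  have h1 : δ * s * w ≤ r * (2 * M) * 1 := by gcongr
  have h2 : 1 * (r * M) ≤ x * (r * M) := mul_le_mul_of_nonneg_right hx (by positivity)
  linarith

lemma pencilError_le {ε M r w s δ : ℝ} (hε : 0 ≤ ε) (hw : 0 < w) (hs : 0 < s) (hδ : 0 < δ)
    (hr : δ ≤ r) (hM : δ ≤ M) :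
    n * pencilError m ε M r w s ≤ 4 * m * ε * (n * r * M / (δ * s * w)) := by
  have h1 : M + r ≤ 2 * (r * M / δ) := by
    have h2 : M ≤ r * M / δ := by
      rw [le_div_iff₀ hδ]; nlinarith
    have h3 : r ≤ r * M / δ := by
      rw [le_div_iff₀ hδ]; nlinarith
    linarith
  have hp : 0 ≤ n * (2 * ε * m) / (w * s) := by positivity
  calc n * pencilError m ε M r w s = n * (2 * ε * m) / (w * s) * (M + r) := by
        rw [pencilError]; ring
    _ ≤ n * (2 * ε * m) / (w * s) * (2 * (r * M / δ)) := by gcongr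
    _ = _ := by field_simp; ring

end Factors

/-! ### Perturbation of the node matrix -/

section NodeMatrix

variable {d m n : ℕ} {t : Fin m → Fin d → ℝ} {z' : Fin m → Fin d → ℂ} {e : ℝ}

lemma norm_nodeMatrix_nodes_pos (hm : 0 < m) : 0 < ‖nodeMatrix n (nodes t)‖ := by
  refine one_pos.trans_le ((norm_nodeMatrix_nodes t ⟨0, hm⟩ (0 : Grid d n)).ge.trans ?_)
  exact norm_entry_le _ _ _

lemma norm_nodeMatrix_sub_le (he : 0 ≤ e) (hne : n * d * e ≤ 1)
    (hz : ∀ j l, ‖z' j l - nodes t j l‖ ≤ e) :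
    ‖nodeMatrix n z' - nodeMatrix n (nodes t)‖ ≤
      2 * (n * d * e) * ‖nodeMatrix n (nodes t)‖ :=
  frobenius_le_of_entry_le (by positivity) fun j k => by
    rw [norm_nodeMatrix_nodes, mul_one]
    exact norm_nodeMatrix_entry_sub_le he (fun l => (norm_nodes t j l).le) (hz j) hne k

lemma norm_nodeMatrix_sub_le_of_near (he : 0 ≤ e) (hne : n * d * e ≤ 1 / 2)
    (hz : ∀ j, ∃ p, ∀ l, ‖z' j l - nodes t p l‖ ≤ e) :
    ‖nodeMatrix n z' - nodeMatrix n (nodes t)‖ ≤ 3 * ‖nodeMatrix n (nodes t)‖ :=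
  frobenius_le_of_entry_le (by norm_num) fun j k => by
    obtain ⟨p, hp⟩ := hz j
    have h1 := norm_nodeMatrix_entry_sub_le he (fun l => (norm_nodes t p l).le) hp
      (hne.trans (by norm_num)) k
    have h2 := norm_sub_le_norm_sub_add_norm_sub (nodeMatrix n z' j k)
      (nodeMatrix n (nodes t) p k) (nodeMatrix n (nodes t) j k)
    have h3 := norm_sub_le (nodeMatrix n (nodes t) p k) (nodeMatrix n (nodes t) j k)
    rw [norm_nodeMatrix_nodes, norm_nodeMatrix_nodes] at h3
    rw [norm_nodeMatrix_nodes, mul_one]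
    change ‖nodeMatrix n z' j k - nodeMatrix n (nodes t) j k‖ ≤ 3
    linarith

/-- A node that is near an exact node with another index moves the node matrix by at least its
smallest singular value. -/
lemma svMin_le_norm_nodeMatrix_sub (hr : (nodeMatrix n (nodes t)).rank = m) (he : 0 ≤ e)
    (hne : n * d * e ≤ 1 / 2)
    (hsmall : 2 * (n * d * e) * ‖nodeMatrix n (nodes t)‖ ≤ svMin (nodeMatrix n (nodes t)) / 4)
    {i p : Fin m} (hpi : p ≠ i) (hz : ∀ l, ‖z' i l - nodes t p l‖ ≤ e) :
    svMin (nodeMatrix n (nodes t)) ≤ ‖nodeMatrix n z' - nodeMatrix n (nodes t)‖ := by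
  set A := nodeMatrix n (nodes t) with hA
  set A' := nodeMatrix n z' with hA'
  have h1 : svMin A * (5 / 4) ≤ norm2 (A p - A i) := by
    have e1 : A p - A i = Aᵀ *ᵥ (Pi.single p 1 - Pi.single i 1) := by
      rw [Matrix.mulVec_sub, Matrix.mulVec_single_one, Matrix.mulVec_single_one]
      rfl
    -- the norm is `√2`, and `5 / 4` leaves room for the term `svMin A / 4`
    have e2 : 5 / 4 ≤ norm2 (Pi.single p 1 - Pi.single i 1 : Fin m → ℂ) := by
      refine le_of_sq_le_sq ?_ (norm2_nonneg _)
      have h3 : ∑ j ∈ {p, i}, ‖(Pi.single p 1 - Pi.single i 1 : Fin m → ℂ) j‖ ^ 2 ≤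
          ∑ j, ‖(Pi.single p 1 - Pi.single i 1 : Fin m → ℂ) j‖ ^ 2 :=
        Finset.sum_le_sum_of_subset_of_nonneg (Finset.subset_univ _)
          fun _ _ _ => sq_nonneg _
      rw [Finset.sum_pair hpi] at h3
      simp [hpi, hpi.symm] at h3
      rw [norm2_sq]
      simp only [Pi.sub_apply]
      linarith
    rw [e1]
    refine le_trans ?_ (sv_mul_norm2_le_transpose A _)
    rw [svMin_of_rank_eq_card (by rw [hr, Fintype.card_fin])]
    exact mul_le_mul_of_nonneg_left e2 (sv_nonneg _ _)
  have h2 : norm2 (A' i - A p) ≤ 2 * (n * d * e) * ‖A‖ := by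
    have h3 : norm2 (A' i - A p) ≤ 2 * (n * d * e) * norm2 (A i) := by
      refine norm2_le_of_sq_le (by have := norm2_nonneg (A i); positivity) ?_
      rw [mul_pow, norm2_sq, Finset.mul_sum]
      refine Finset.sum_le_sum fun k _ => ?_
      rw [← mul_pow, hA, norm_nodeMatrix_nodes, mul_one]
      exact pow_le_pow_left₀ (norm_nonneg _) (norm_nodeMatrix_entry_sub_le he
        (fun l => (norm_nodes t p l).le) hz (hne.trans (by norm_num)) k) 2
    exact h3.trans (mul_le_mul_of_nonneg_left (norm2_row_le A i) (by positivity))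
  have h3 : norm2 (A p - A i) ≤ norm2 (A' i - A i) + norm2 (A' i - A p) := by
    have := norm2_sub_le (A' i - A i) (A' i - A p)
    rwa [sub_sub_sub_cancel_left] at this
  have h4 : norm2 (A' i - A i) ≤ ‖A' - A‖ := norm2_row_le (A' - A) i
  linarith

lemma one_le_of_svMin_le {A A' : Matrix (Fin m) (Grid d n) ℂ} {ε : ℝ} (hA : 0 < ‖A‖)
    (hs : 0 < svMin A) (h : svMin A ≤ ‖A' - A‖) : 1 ≤ cond2 A * √(m : ℝ) * lsqLevel A A' ε := by
  have h1 : ‖A‖ ≤ √(m : ℝ) * sv A 0 := by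
    simpa using frobenius_le_sqrt_card_mul_sv A
  have h2 : ‖A' - A‖ / ‖A‖ ≤ lsqLevel A A' ε := le_max_left _ _
  calc (1 : ℝ) ≤ (√(m : ℝ) * sv A 0 / ‖A‖) * (‖A' - A‖ / svMin A) :=
        one_le_mul_of_one_le_of_one_le ((one_le_div hA).mpr h1) ((one_le_div hs).mpr h)
    _ = cond2 A * √(m : ℝ) * (‖A' - A‖ / ‖A‖) := by rw [cond2]; ring
    _ ≤ _ := mul_le_mul_of_nonneg_left h2 (mul_nonneg (cond2_nonneg A) (Real.sqrt_nonneg _))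

end NodeMatrix

/-! ### The two error bounds -/

section Main

variable {d m n : ℕ} {t : Fin m → Fin d → ℝ} {c : Fin m → ℂ} {μ : Fin d → ℂ}
  {U V : Matrix (Grid d n) (Fin m) ℂ} {W : Matrix (Fin m) (Fin m) ℂ} {lam : Fin m → ℂ}

lemma lsqLevel_nonneg {A A' : Matrix (Fin m) (Grid d n) ℂ} {ε : ℝ} : 0 ≤ lsqLevel A A' ε :=
  le_max_of_le_left (by positivity)

lemma coefficient_error_le (hr : (sampleMatrix n (expSum t c)).rank = m) {ε : ℝ} (hε : 0 ≤ ε)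
    {f' : (Fin d → ℤ) → ℂ} (hf : ∀ k, ‖f' k - expSum t c k‖ ≤ ε * ‖expSum t c k‖)
    {A A' : Matrix (Fin m) (Grid d n) ℂ} (hA : A = nodeMatrix n (nodes t)) {c' : Fin m → ℂ}
    (hx : cond2 A * √(m : ℝ) * lsqLevel A A' ε < 1)
    (h : IsLeastSquares A'ᵀ (sampleVector n f') c') :
    norm2 (c' - c) / norm2 c ≤ 2 * (cond2 A * √(m : ℝ) * lsqLevel A A' ε) /
      (1 - cond2 A * √(m : ℝ) * lsqLevel A A' ε) := by
  set ζ := lsqLevel A A' ε with hζ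
  have hζ0 : 0 ≤ ζ := lsqLevel_nonneg
  have hrhs : 0 ≤ 2 * (cond2 A * √(m : ℝ) * ζ) / (1 - cond2 A * √(m : ℝ) * ζ) :=
    div_nonneg (by have := cond2_nonneg A; positivity) (by linarith)
  rcases Nat.eq_zero_or_pos m with rfl | hm
  · rw [norm2_eq_zero.mpr (Subsingleton.elim (c' - c) 0), zero_div]
    exact hrhs
  have hA0 : 0 < ‖A‖ := hA ▸ norm_nodeMatrix_nodes_pos hm
  have h1 : ‖A' - A‖ ≤ ζ * ‖A‖ := by
    rw [← div_le_iff₀ hA0]; exact le_max_left _ _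
  have h2 : ε ≤ √(m : ℝ) * ζ := by
    have hm0 : 0 < √(m : ℝ) := by positivity
    rw [← div_le_iff₀' hm0]; exact le_max_right _ _
  have hb : sampleVector n (expSum t c) = Aᵀ *ᵥ c := hA ▸ sampleVector_expSum t c
  have h3 := norm2_sampleVector_sub_le (n := n) hε hf
  rw [hb] at h3
  have hrA : A.rank = Fintype.card (Fin m) := by
    rw [hA, rank_nodeMatrix hr, Fintype.card_fin]
  have h4 := h.forward_error hrA h1 (by
    rw [Fintype.card_fin]
    exact h3.trans (mul_le_mul_of_nonneg_right h2 (norm2_nonneg _))) hζ0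
  rw [Fintype.card_fin] at h4
  rcases (norm2_nonneg c).eq_or_lt with hc | hc
  · rw [← hc, div_zero]; exact hrhs
  · rw [div_le_div_iff₀ hc (by linarith)]
    exact h4

lemma eventually_mul_lt (a : ℝ) {b : ℝ} (hb : 0 < b) : ∀ᶠ ε in nhds (0 : ℝ), a * ε < b :=
  (by fun_prop : Continuous fun ε : ℝ => a * ε).continuousAt.eventually_lt continuousAt_const
    (by simpa using hb)

/-- Finitely many linear smallness conditions hold on a common interval. -/
lemma exists_radius (a₁ a₂ a₃ a₄ a₅ : ℝ) {b₁ b₂ b₃ b₄ b₅ : ℝ} (h₁ : 0 < b₁) (h₂ : 0 < b₂)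
    (h₃ : 0 < b₃) (h₄ : 0 < b₄) (h₅ : 0 < b₅) : ∃ ε₀ : ℝ, 0 < ε₀ ∧ ∀ ε, 0 ≤ ε → ε ≤ ε₀ →
      a₁ * ε < b₁ ∧ a₂ * ε < b₂ ∧ a₃ * ε < b₃ ∧ a₄ * ε < b₄ ∧ a₅ * ε < b₅ := by
  have h := ((eventually_mul_lt a₁ h₁).and ((eventually_mul_lt a₂ h₂).and
    ((eventually_mul_lt a₃ h₃).and ((eventually_mul_lt a₄ h₄).and (eventually_mul_lt a₅ h₅)))))
  obtain ⟨r, hr, hball⟩ := Metric.eventually_nhds_iff.mp h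
  refine ⟨r / 2, by positivity, fun ε h0 hle => hball ?_⟩
  rw [Real.dist_eq, sub_zero, abs_of_nonneg h0]
  linarith

/-- The step from the bound for `ζ` to the bound for the least squares error. -/
lemma two_mul_div_one_sub_le {κ ζ q k ε : ℝ} (hκ : 0 ≤ κ) (hζ : ζ ≤ q + k * ε ^ 2)
    (hx : κ * ζ ≤ 1 / 2) (hx0 : 0 ≤ κ * ζ) :
    2 * (κ * ζ) / (1 - κ * ζ) ≤ 4 * (κ * q) + 4 * κ * k * ε ^ 2 := by
  have h1 : 2 * (κ * ζ) / (1 - κ * ζ) ≤ 4 * (κ * ζ) := by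
    rw [div_le_iff₀ (by linarith)]
    nlinarith
  have h2 := mul_le_mul_of_nonneg_left hζ hκ
  linarith

/-- The bounds for the level of the perturbation. Either every extracted node is near the exact node
with the same index, and the first-order analysis applies; or some extracted node is near an exact
node with another index, and then `γ = O(ε)`, so that `Q ε` is bounded from below, while
`κ₂(A) √m ζ ≥ 1`. -/
theorem exists_lsqLevel_bounds (hm : 2 ≤ m) (hr : (sampleMatrix n (expSum t c)).rank = m)
    (hc : ∀ j, c j ≠ 0) (hμ : norm2 μ = 1) (h : IsPencilRun n (expSum t c) μ U V W lam)
    (hz : ∀ l, W⁻¹ * pencilMatrix n (expSum t c) U V l * W =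
      Matrix.diagonal fun j => nodes t j l) :
    ∃ K ε₀ : ℝ, 0 < K ∧ 0 < ε₀ ∧
      ∀ (ε : ℝ) (f' : (Fin d → ℤ) → ℂ) (U' V' : Matrix (Grid d n) (Fin m) ℂ)
        (W' : Matrix (Fin m) (Fin m) ℂ) (lam' : Fin m → ℂ) (A A' : Matrix (Fin m) (Grid d n) ℂ)
        (ζ Q : ℝ), 0 ≤ ε → ε ≤ ε₀ →
        (∀ k, ‖f' k - expSum t c k‖ ≤ ε * ‖expSum t c k‖) →
        IsPencilRun n f' μ U' V' W' lam' →
        A = nodeMatrix n (nodes t) →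
        A' = nodeMatrix n (extractedNodes n f' U' V' W') →
        ζ = lsqLevel A A' ε →
        Q = amplification n (expSum t c) f' W lam lam' →
        0 < eigGap lam lam' →
        0 < svGap m (sampleMatrix n (expSum t c)) (sampleMatrix n f') →
        ζ ≤ 192 * Q * ε + K * ε ^ 2 ∧
        (cond2 A * √(m : ℝ) * ζ < 1 →
          2 * (cond2 A * √(m : ℝ) * ζ) / (1 - cond2 A * √(m : ℝ) * ζ) ≤
            192 * (√(m : ℝ) * cond2 A * Q) * ε + K * ε ^ 2) := by
  have hm0 : 0 < m := by omega
  have : Nonempty (Fin m) := ⟨⟨0, hm0⟩⟩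
  have hd : 0 < d := by
    rcases Nat.eq_zero_or_pos d with rfl | hd
    · rw [norm2_eq_zero.mpr (Subsingleton.elim μ 0)] at hμ
      exact absurd hμ zero_ne_one
    · exact hd
  have hn : 0 < n := by
    rcases Nat.eq_zero_or_pos n with rfl | hn
    · have h1 := Matrix.rank_le_card_width (sampleMatrix 0 (expSum t c))
      rw [hr] at h1
      simp at h1
      omega
    · exact hn
  obtain ⟨g, hg, hsep⟩ := exists_separation h.distinct
  have hs := sv_pos_of_rank_eq hm0 hr
  have hw : 0 < svMin W := svMin_pos_of_isUnit ((Matrix.isUnit_iff_isUnit_det W).mpr h.isUnit_det)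
  have hw1 := h.svMin_le_one hm0
  have hκW := one_le_cond2 hw
  have hrA := rank_nodeMatrix hr
  have hsA : 0 < svMin (nodeMatrix n (nodes t)) := by
    rw [svMin_of_rank_eq_card (by rw [hrA, Fintype.card_fin]), sv_pos_iff, hrA, Fintype.card_fin]
    omega
  have hA0 : 0 < ‖nodeMatrix n (nodes t)‖ := norm_nodeMatrix_nodes_pos hm0
  have hMl : ∀ l, ‖shiftedMatrix n (expSum t c) l‖ ≤ ⨆ l, ‖shiftedMatrix n (expSum t c) l‖ :=
    fun l => le_ciSup (f := fun l => ‖shiftedMatrix n (expSum t c) l‖)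
      (Set.finite_range _).bddAbove l
  have hMs := (h.sv_le_norm_shiftedMatrix hm0 hr hz ⟨0, hd⟩).trans (hMl _)
  have hTs := sv_le_frobenius (sampleMatrix n (expSum t c)) (m - 1)
  set M := ⨆ l, ‖shiftedMatrix n (expSum t c) l‖ with hM
  set T := sampleMatrix n (expSum t c) with hT
  set s := sv T (m - 1) with hsdef
  have hM0 : 0 < M := hs.trans_le hMs
  have hT0 : 0 < ‖T‖ := hs.trans_le hTs
  have hd1 : (1 : ℝ) ≤ d := by exact_mod_cast hd
  have hn1 : (1 : ℝ) ≤ n := by exact_mod_cast hn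
  have hm1 : (1 : ℝ) ≤ m := by exact_mod_cast hm0
  have hsd : 1 ≤ √(d : ℝ) := Real.one_le_sqrt.mpr hd1
  have hsm : 1 ≤ √(m : ℝ) := Real.one_le_sqrt.mpr hm1
  have hκA : 0 ≤ cond2 (nodeMatrix n (nodes t)) := cond2_nonneg _
  -- the norms of the `H_l` are at most `K₁ ε`, and the errors of the nodes at most `K₂ ε`
  set K₁ := 4 * m * (M + ‖T‖) / (svMin W * s) with hK₁
  have hK₁0 : 0 < K₁ := by positivity
  set K₂ := (2 + 2 * √(d : ℝ) / g) * K₁ with hK₂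
  have hK₂' : 0 ≤ 2 + 2 * √(d : ℝ) / g := by positivity
  have hK₂0 : 0 < K₂ := by positivity
  set K₃ := 2 * n * d * (16 * d * K₁ ^ 2 / g ^ 2) with hK₃
  have hK₃0 : 0 < K₃ := by positivity
  set κm := cond2 (nodeMatrix n (nodes t)) * √(m : ℝ) with hκm
  have hκm0 : 0 ≤ κm := by positivity
  -- `ε₀` keeps the dominant singular spaces close, the eigenvalues separated and the monomials in
  -- their linear regime, makes a renumbering visible in `A`, and otherwise gives
  -- `κ₂(A) √m ζ ≤ 1 / 2`
  obtain ⟨ε₀, hε₀, hrad⟩ := exists_radius ‖T‖ (√(d : ℝ) * K₁) (n * d * K₂)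
    (2 * (n * d * K₂) * ‖nodeMatrix n (nodes t)‖) (κm * (2 * (n * d * K₂) + 1))
    (b₁ := s / 4) (b₂ := g / 8) (b₃ := 1 / 2) (b₄ := svMin (nodeMatrix n (nodes t)) / 4)
    (b₅ := 1 / 2) (by positivity) (by positivity) (by norm_num) (by positivity) (by norm_num)
  clear_value K₁ K₂ K₃
  refine ⟨K₃ + 4 * κm * K₃ + 1, ε₀, by positivity, hε₀, ?_⟩
  intro ε f' U' V' W' lam' A A' ζ Q hε hεle hf h' hA hA' hζ hQ hγ hδ
  subst hA
  obtain ⟨r₁, r₂, r₃, r₄, r₅⟩ := hrad ε hε hεle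
  have hεT : ε * ‖T‖ ≤ s / 4 := by linarith
  have hδs := svGap_le hm0 T (sampleMatrix n f')
  have hΔ := (norm_sampleMatrix_sub_le (n := n) hε hf).trans hεT
  have hs'l : s / 2 ≤ sv (sampleMatrix n f') (m - 1) := by
    have h1 := sv_le_add T (sampleMatrix n f') (m - 1)
    rw [norm_sub_rev] at h1
    linarith
  have hs'u : sv (sampleMatrix n f') (m - 1) ≤ 2 * s := by
    have h1 := sv_le_add (sampleMatrix n f') T (m - 1)
    linarith
  obtain ⟨X, hXu, H, hsim, hH⟩ := h.exists_similar hm0 hr hc hz hε hf h'.svd hεT hMl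
  have hRQ := mul_le_eigGap_mul_amplification (n := n) (f := expSum t c) (f' := f') hd hm0 hκW hw
    hγ hδ (by linarith)
  have hnh₀ := pencilError_le (n := n) (m := m) hε hw
    (by linarith : 0 < sv (sampleMatrix n f') (m - 1)) hδ (hδs.trans hTs) (hδs.trans hMs)
  rw [← hQ] at hRQ
  set s' := sv (sampleMatrix n f') (m - 1) with hs'
  have hs'0 : 0 < s' := by linarith
  set δ := svGap m T (sampleMatrix n f') with hδdef
  set γ := eigGap lam lam' with hγdef
  set h₀ := pencilError m ε M ‖T‖ (svMin W) s' with hh₀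
  have h₀0 : 0 ≤ h₀ := pencilError_nonneg hε hM0.le hT0.le hw.le hs'0.le
  have h₀K : h₀ ≤ K₁ * ε := by
    rw [hK₁]
    exact pencilError_le_mul hε hM0.le hT0.le hw hs hs'l
  have hh₀g : √(d : ℝ) * h₀ ≤ g / 8 := by
    have := mul_le_mul_of_nonneg_left h₀K (Real.sqrt_nonneg (d : ℝ))
    linarith
  have hnear := fun i => h'.exists_node_near (fun j l => (norm_nodes t j l).le) hμ
    (h.eigenvalue_eq hz) hXu hsim h₀0 hH hg hsep hh₀g i
  have hγle : ∀ i j, j ≠ i → γ ≤ ‖lam j - lam' i‖ := fun i j hij => eigGap_le lam lam' hij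
  set R := n * ‖T‖ * M / (δ * s' * svMin W) with hR
  have hR2 : 1 / 2 ≤ R :=
    half_le_quotient hn1 hδ hs'0 hw hw1 (hδs.trans hTs) (by linarith)
  have hR0 : 0 < R := by linarith
  clear_value R h₀ γ δ s' s T M
  set e := 16 * d * h₀ ^ 2 / g ^ 2 + 2 * h₀ with he
  have hd0 : (0 : ℝ) ≤ d := Nat.cast_nonneg d
  have he0 : 0 ≤ e := add_nonneg (div_nonneg (mul_nonneg (by linarith) (sq_nonneg _))
    (sq_nonneg _)) (by linarith)
  have heK : e ≤ K₂ * ε := by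
    have h2 : (2 + 2 * √(d : ℝ) / g) * h₀ ≤ (2 + 2 * √(d : ℝ) / g) * (K₁ * ε) :=
      mul_le_mul_of_nonneg_left h₀K hK₂'
    have h3 : e ≤ (2 + 2 * √(d : ℝ) / g) * h₀ := node_error_le hd0 hg h₀0 hh₀g
    rw [hK₂]
    linarith
  clear_value e
  have hneK : n * d * e ≤ n * d * K₂ * ε := by
    have := mul_le_mul_of_nonneg_left heK (by positivity : (0 : ℝ) ≤ n * d)
    linarith
  have hne : n * d * e ≤ 1 / 2 := by linarith
  -- a bound for `γ` in terms of the dimension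
  have hγd : γ ≤ 3 * √(d : ℝ) := by
    obtain ⟨p, hp, -⟩ := hnear ⟨0, hm0⟩
    have h1 := hγle ⟨0, hm0⟩ ⟨1, hm⟩ (by simp [Fin.ext_iff])
    have h2 := norm_sub_le_norm_sub_add_norm_sub (lam ⟨1, hm⟩) (lam p) (lam' ⟨0, hm0⟩)
    have h3 := norm_sub_le (lam ⟨1, hm⟩) (lam p)
    have h4 := hsep ⟨0, hm0⟩ ⟨1, hm⟩ (by simp [Fin.ext_iff])
    have h5 := norm_sub_le (lam ⟨0, hm0⟩) (lam ⟨1, hm⟩)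
    linarith [h.norm_eigenvalue_le hμ hz ⟨1, hm⟩, h.norm_eigenvalue_le hμ hz ⟨0, hm0⟩,
      h.norm_eigenvalue_le hμ hz p]
  have hQ0 : 0 ≤ Q := by
    have h1 : 0 ≤ γ * Q := le_trans (by positivity) hRQ
    exact (mul_nonneg_iff_of_pos_left hγ).mp h1
  have hdmR : d * m * R ≤ 3 * Q := by
    have h1 : √(d : ℝ) * (d * m * R) ≤ √(d : ℝ) * (3 * Q) := by
      have := mul_le_mul_of_nonneg_right hγd hQ0
      linarith
    exact le_of_mul_le_mul_left h1 (by linarith)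
  have hεQ : ε / √(m : ℝ) ≤ 6 * Q * ε := by
    have h1 : ε / √(m : ℝ) ≤ ε := div_le_self hε hsm
    have h2 : 1 ≤ 6 * Q := by
      have h3 : 1 * R ≤ d * m * R :=
        mul_le_mul_of_nonneg_right (one_le_mul_of_one_le_of_one_le hd1 hm1) hR0.le
      linarith
    have := mul_le_mul_of_nonneg_right h2 hε
    linarith
  have hQε : 0 ≤ Q * ε := mul_nonneg hQ0 hε
  have hε2 : 0 ≤ ε ^ 2 := sq_nonneg ε
  have hK₃ε : 0 ≤ K₃ * ε ^ 2 := by positivity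
  have hκε : 0 ≤ κm * K₃ * ε ^ 2 := by positivity
  by_cases hid : ∀ i, ∀ l, ‖extractedNodes n f' U' V' W' i l - nodes t i l‖ ≤ e
  · -- the numberings match: first-order analysis
    have hA1 : ‖A' - nodeMatrix n (nodes t)‖ / ‖nodeMatrix n (nodes t)‖ ≤ 2 * (n * d * e) := by
      rw [div_le_iff₀ hA0, hA']
      exact norm_nodeMatrix_sub_le he0 (hne.trans (by norm_num)) hid
    have hne2 : 2 * (n * d * e) ≤ 48 * Q * ε + K₃ * ε ^ 2 := by
      have h1 : 2 * (n * d) * (16 * d * h₀ ^ 2 / g ^ 2) ≤ K₃ * ε ^ 2 := by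
        have h2 : h₀ ^ 2 ≤ (K₁ * ε) ^ 2 := pow_le_pow_left₀ h₀0 h₀K 2
        calc 2 * (n * d) * (16 * d * h₀ ^ 2 / g ^ 2)
            ≤ 2 * (n * d) * (16 * d * (K₁ * ε) ^ 2 / g ^ 2) := by gcongr
          _ = _ := by rw [hK₃]; ring
      have h3 : 4 * d * (n * h₀) ≤ 4 * d * (4 * m * ε * R) :=
        mul_le_mul_of_nonneg_left hnh₀ (by positivity)
      have h4 := mul_le_mul_of_nonneg_right hdmR hε
      rw [he]
      linarith
    have hζ1 : ζ ≤ 48 * Q * ε + K₃ * ε ^ 2 := by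
      rw [hζ, lsqLevel]
      exact max_le (hA1.trans hne2) (hεQ.trans (by linarith))
    have hζ2 : ζ ≤ (2 * (n * d * K₂) + 1) * ε := by
      rw [hζ, lsqLevel]
      have h1 : 0 ≤ n * d * K₂ * ε := by positivity
      exact max_le (hA1.trans (by linarith)) ((div_le_self hε hsm).trans (by linarith))
    have hζ0 : 0 ≤ ζ := hζ ▸ lsqLevel_nonneg
    refine ⟨by linarith, fun _ => ?_⟩
    have hx : κm * ζ ≤ 1 / 2 := by
      have := mul_le_mul_of_nonneg_left hζ2 hκm0
      linarith
    refine (two_mul_div_one_sub_le hκm0 hζ1 hx (mul_nonneg hκm0 hζ0)).trans ?_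
    have e1 : 192 * (√(m : ℝ) * cond2 (nodeMatrix n (nodes t)) * Q) * ε =
        4 * (κm * (48 * Q * ε)) := by rw [hκm]; ring
    rw [e1]
    linarith
  · -- some extracted node is near an exact node with another index
    push Not at hid
    obtain ⟨i, l₀, hil⟩ := hid
    obtain ⟨p, hp, hpz⟩ := hnear i
    have hpi : p ≠ i := by
      rintro rfl
      exact absurd (hpz l₀) (not_le.mpr hil)
    constructor
    · have hγh : γ ≤ √(d : ℝ) * h₀ := (hγle i p hpi).trans hp
      have hQ4 : 1 / 4 ≤ Q * ε := by
        have h1 : d * √(d : ℝ) * (n * h₀) ≤ d * √(d : ℝ) * (4 * m * ε * R) :=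
          mul_le_mul_of_nonneg_left hnh₀ (by positivity)
        have h2 : 1 * (√(d : ℝ) * h₀) ≤ (d * n) * (√(d : ℝ) * h₀) :=
          mul_le_mul_of_nonneg_right (one_le_mul_of_one_le_of_one_le hd1 hn1) (by positivity)
        have h3 := mul_le_mul_of_nonneg_right hRQ hε
        have h4 : γ * (1 / 4) ≤ γ * (Q * ε) := by linarith
        exact le_of_mul_le_mul_left h4 hγ
      have h3 : ζ ≤ 12 * Q * ε := by
        rw [hζ, lsqLevel]
        refine max_le ?_ (hεQ.trans (by linarith))
        have h4 : ‖A' - nodeMatrix n (nodes t)‖ / ‖nodeMatrix n (nodes t)‖ ≤ 3 := by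
          rw [div_le_iff₀ hA0, hA']
          exact norm_nodeMatrix_sub_le_of_near he0 hne
            fun j => (hnear j).imp fun q hq => hq.2
        linarith
      linarith
    · intro hlt
      have hsmall : 2 * (n * d * e) * ‖nodeMatrix n (nodes t)‖ ≤
          svMin (nodeMatrix n (nodes t)) / 4 := by
        have := mul_le_mul_of_nonneg_right hneK hA0.le
        linarith
      have h1 := svMin_le_norm_nodeMatrix_sub hrA he0 hne hsmall hpi hpz
      rw [← hA'] at h1
      have h2 := one_le_of_svMin_le (ε := ε) hA0 hsA h1
      rw [hζ] at hlt
      exact absurd hlt (not_lt.mpr h2)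

end Main

lemma norm2_comp_perm {m : ℕ} (τ : Equiv.Perm (Fin m)) (c : Fin m → ℂ) :
    norm2 (fun j => c (τ j)) = norm2 c := by
  rw [← sq_eq_sq₀ (norm2_nonneg _) (norm2_nonneg _), norm2_sq, norm2_sq]
  exact Equiv.sum_comp τ fun j => ‖c j‖ ^ 2

end Prony

theorem mainTheorem2 :
    ∃ C : ℝ, 0 < C ∧
      ∀ (d m n : ℕ) (t : Fin m → Fin d → ℝ) (c : Fin m → ℂ) (μ : Fin d → ℂ)
        (U V : Matrix (Prony.Grid d n) (Fin m) ℂ) (W : Matrix (Fin m) (Fin m) ℂ)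
        (lam : Fin m → ℂ),
        (∀ j l, t j l ∈ Set.Ico (0 : ℝ) 1) → Function.Injective t → (∀ j, c j ≠ 0) →
        Prony.norm2 μ = 1 →
        (Prony.sampleMatrix n (Prony.expSum t c)).rank = m →
        Prony.IsPencilRun n (Prony.expSum t c) μ U V W lam →
        ∃ τ : Equiv.Perm (Fin m),
          (∀ l, W⁻¹ * Prony.pencilMatrix n (Prony.expSum t c) U V l * W =
            Matrix.diagonal fun j => Prony.nodes t (τ j) l) ∧
          (∀ (ε : ℝ) (f' : (Fin d → ℤ) → ℂ) (U' V' : Matrix (Prony.Grid d n) (Fin m) ℂ)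
            (W' : Matrix (Fin m) (Fin m) ℂ) (lam' : Fin m → ℂ) (c' : Fin m → ℂ)
            (A A' : Matrix (Fin m) (Prony.Grid d n) ℂ) (ζ : ℝ),
            0 ≤ ε →
            (∀ k, ‖f' k - Prony.expSum t c k‖ ≤ ε * ‖Prony.expSum t c k‖) →
            Prony.IsPencilRun n f' μ U' V' W' lam' →
            A = Prony.nodeMatrix n (fun j => Prony.nodes t (τ j)) →
            A' = Prony.nodeMatrix n (Prony.extractedNodes n f' U' V' W') →
            ζ = Prony.lsqLevel A A' ε →
            Prony.cond2 A * √(m : ℝ) * ζ < 1 →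
            Prony.IsLeastSquares A'ᵀ (Prony.sampleVector n f') c' →
            Prony.norm2 (fun j => c' j - c (τ j)) / Prony.norm2 c ≤
              2 * (Prony.cond2 A * √(m : ℝ) * ζ) / (1 - Prony.cond2 A * √(m : ℝ) * ζ)) ∧
          (2 ≤ m → ∃ K ε₀ : ℝ, 0 < K ∧ 0 < ε₀ ∧
            ∀ (ε : ℝ) (f' : (Fin d → ℤ) → ℂ) (U' V' : Matrix (Prony.Grid d n) (Fin m) ℂ)
              (W' : Matrix (Fin m) (Fin m) ℂ) (lam' : Fin m → ℂ)
              (A A' : Matrix (Fin m) (Prony.Grid d n) ℂ) (ζ Q : ℝ),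
              0 ≤ ε → ε ≤ ε₀ →
              (∀ k, ‖f' k - Prony.expSum t c k‖ ≤ ε * ‖Prony.expSum t c k‖) →
              Prony.IsPencilRun n f' μ U' V' W' lam' →
              A = Prony.nodeMatrix n (fun j => Prony.nodes t (τ j)) →
              A' = Prony.nodeMatrix n (Prony.extractedNodes n f' U' V' W') →
              ζ = Prony.lsqLevel A A' ε →
              Q = Prony.amplification n (Prony.expSum t c) f' W lam lam' →
              0 < Prony.eigGap lam lam' →
              0 < Prony.svGap m (Prony.sampleMatrix n (Prony.expSum t c))
                (Prony.sampleMatrix n f') →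
              ζ ≤ C * Q * ε + K * ε ^ 2 ∧
              (Prony.cond2 A * √(m : ℝ) * ζ < 1 →
                2 * (Prony.cond2 A * √(m : ℝ) * ζ) / (1 - Prony.cond2 A * √(m : ℝ) * ζ) ≤
                  C * (√(m : ℝ) * Prony.cond2 A * Q) * ε + K * ε ^ 2)) := by
  refine ⟨192, by norm_num, ?_⟩
  intro d m n t c μ U V W lam _ _ hc hμ hr h
  obtain ⟨τ, hτ⟩ := h.exists_perm hr
  refine ⟨τ, hτ, ?_, fun hm => ?_⟩
  · intro ε f' U' V' W' lam' c' A A' ζ hε hf _ hA _ hζ hx hls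
    rw [← Prony.expSum_comp_perm t c τ] at hr hf
    subst hζ
    rw [← Prony.norm2_comp_perm τ c]
    exact Prony.coefficient_error_le hr hε hf hA hx hls
  · rw [← Prony.expSum_comp_perm t c τ] at hr h hτ ⊢
    exact Prony.exists_lsqLevel_bounds hm hr (fun j => hc (τ j)) hμ h hτ
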